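/- Let $G=G_1 *_A G_2$ be an amalgam of finite groups (with respect to two monomorphisms $A\to G_1$, $A\to G_2$), and let $X=X_1\sqcup X_2$ be a finite set of symbols, where $X_i$ generates $G_i$. Words are words in $X^{\pm}$. **Definitions.** Graphs are labelled with $X^{\pm}$ (the reverse of an edge labelled $x$ is labelled $x^{-1}$, and no two edges with the same label have the same endpoints). $\mathrm{Lab}(\Gamma,v)\subseteq G$ is the set of elements represented by labels of closed paths at $v$. An $X_i$-monochromatic component of $\Gamma$ is a maximal connected subgraph with at least one edge and all labels in $X_i^{\pm}$; a vertex is bichromatic if edges of both colours start at it, and $VB(C)$ is the set of vertices of $C$ that are bichromatic in $\Gamma$. A *precover* of $G$ is a connected graph in which every path whose label equals $1$ in $G$ is closed, and each of whose $X_i$-monochromatic components is isomorphic to a relative Cayley graph $\mathrm{Cayley}(G_i,S)$ with $S\le G_i$ ($i=1,2$); a single vertex without edges is allowed. Let $v_0$ be a vertex of a precover $\Gamma$. A monochromatic component $C$ is *redundant with respect to $v_0$* if either $C$ is the only monochromatic component of $\Gamma$ and $\mathrm{Lab}(C,v)=\{1\}$ for $v\in V(C)$; or $\Gamma$ has at least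 two monochromatic components and, for some $\vartheta\in VB(C)$ with $K=\mathrm{Lab}(C,\vartheta)$, one has $K\le A$ and $VB(C)=\{\vartheta\cdot a: a\in A\}$, and if $v_0\in V(C)$, then $v_0\in VB(C)$ and $K=\{1\}$. The pointed precover $(\Gamma,v_0)$ is *reduced* if it has no component that is redundant with respect to $v_0$, and if $v_0$ is bichromatic whenever $\mathrm{Lab}(C_0,v_0)\cap A\neq\{1\}$ for some monochromatic component $C_0$ containing $v_0$. For a subgroup $H\le G$, a *subgroup graph* $(\Gamma(H),v_0)$ of $H$ is a finite reduced precover of $G$ with $\mathrm{Lab}(\Gamma(H),v_0)=H$. **Theorem.** (1) Let $H\le G$ be finitely generated. Then $H$ has a subgroup graph, and for every subgroup graph $\Gamma(H)$ of $H$ and every non-torsion element $g\in G$ such that $g^n\in H$ for some $n\ge 1$, there exists $1\le z\le |V(\Gamma(H))|$ with $g^z\in H$. (2) There is an algorithm (a computable function, for the fixed amalgam and generators) which, given words $h_1,\dots,h_k$ and a word $g$, finds the minimal $n\ge 1$ such that $g^n$ is a nontrivial element of $H=\langle h_1,\dots,h_k\rangle$, or reports that no such $n$ exists. -/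

import Mathlib

/-! Amalgams `G = G₀ *_A G₁` are Mathlib's `Monoid.PushoutI φ` for a pair of homomorphisms
`φ i : A →* G i` (`i : Fin 2`). The generating symbols form a type `X`, and
`gen : X → Σ i, G i` sends a symbol to its factor (its colour) and to the element of that factor
which it represents, so that `X_i = {x | (gen x).1 = i}` and `X` is the disjoint union of the
`X_i`. A letter of `X^±` is a pair `(x, b) : X × Bool`: `(x, true)` is `x`, `(x, false)` is the
formal inverse of `x`. Words are lists of letters. -/

namespace AmalgamGraph

universe u v w x

/-- A graph with edges labelled by `X^±`: `edge p l q` says that there is an edge from `p` to `q`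
with label `l`; its reverse edge has the inverse label. Two different edges with the same
endpoints and the same label do not occur, as in every well-labelled graph. -/
structure LabelledGraph (X : Type x) (V : Type w) where
  edge : V → X × Bool → V → Prop
  edge_rev : ∀ p y b q, edge p (y, b) q → edge q (y, !b) p

namespace LabelledGraph

variable {X : Type x} {V : Type w}

/-- `Γ.Reads p s q`: there is a path in `Γ` from `p` to `q` with label `s`. -/
inductive Reads (Γ : LabelledGraph X V) : V → List (X × Bool) → V → Prop
  | nil (p : V) : Reads Γ p [] p
  | cons {p q r : V} {l : X × Bool} {s : List (X × Bool)} :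
      Γ.edge p l q → Reads Γ q s r → Reads Γ p (l :: s) r

/-- A connected graph (with at least one vertex). -/
def Connected (Γ : LabelledGraph X V) : Prop :=
  Nonempty V ∧ ∀ p q, ∃ s, Γ.Reads p s q

/-- Two labelled graphs are isomorphic. -/
def Isomorphic {V : Type w} {V' : Type v} (Γ : LabelledGraph X V) (Δ : LabelledGraph X V') :
    Prop :=
  ∃ f : V ≃ V', ∀ p l q, Γ.edge p l q ↔ Δ.edge (f p) l (f q)

end LabelledGraph

section Amalgam

variable {A : Type u} {G : Fin 2 → Type v} [Group A] [∀ i, Group (G i)]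
  (φ : ∀ i, A →* G i) {X : Type x} (gen : X → Σ i, G i) {V : Type w}

/-- The element of the amalgam represented by a letter. -/
def letterVal (l : X × Bool) : Monoid.PushoutI φ :=
  if l.2 then Monoid.PushoutI.of (gen l.1).1 (gen l.1).2
  else (Monoid.PushoutI.of (gen l.1).1 (gen l.1).2)⁻¹

/-- The element of the amalgam represented by a word. -/
def wordVal (s : List (X × Bool)) : Monoid.PushoutI φ :=
  (s.map (letterVal φ gen)).prod

/-- `Lab(Γ, p)`: the elements of the amalgam represented by the labels of the closed paths
at `p`. -/
def Lab (Γ : LabelledGraph X V) (p : V) : Set (Monoid.PushoutI φ) :=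
  {g | ∃ s, Γ.Reads p s p ∧ wordVal φ gen s = g}

/-- The subgraph of all edges of colour `i`, that is, with labels in `X_i^±`. -/
def colourPart (Γ : LabelledGraph X V) (i : Fin 2) : LabelledGraph X V where
  edge p l q := Γ.edge p l q ∧ (gen l.1).1 = i
  edge_rev p y b q h := ⟨Γ.edge_rev p y b q h.1, h.2⟩

/-- Some edge of colour `i` starts at `p`. -/
def HasColour (Γ : LabelledGraph X V) (i : Fin 2) (p : V) : Prop :=
  ∃ l q, (colourPart gen Γ i).edge p l q

/-- Bichromatic vertices. -/
def Bichromatic (Γ : LabelledGraph X V) (p : V) : Prop :=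
  ∀ i, HasColour gen Γ i p

/-- The vertices of the `X_i`-monochromatic component of `p`. (It is a monochromatic component,
that is, it has an edge, if and only if `HasColour gen Γ i p`.) -/
def compVerts (Γ : LabelledGraph X V) (i : Fin 2) (p : V) : Set V :=
  {q | ∃ s, (colourPart gen Γ i).Reads p s q}

/-- The `X_i`-monochromatic component of `p`, as a labelled graph. -/
def component (Γ : LabelledGraph X V) (i : Fin 2) (p : V) :
    LabelledGraph X (compVerts gen Γ i p) where
  edge q l r := (colourPart gen Γ i).edge q l r
  edge_rev q y b r h := (colourPart gen Γ i).edge_rev q y b r h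

/-- The relative Cayley graph `Cayley(G_i, S)` with respect to the generators `X_i`: its vertices
are the right cosets `S g`, and an edge with label `y` leads from `S g` to `S (g y)`. -/
def relCayley (i : Fin 2) (S : Subgroup (G i)) :
    LabelledGraph X (Quotient (QuotientGroup.rightRel S)) where
  edge p l q := ∃ a : G i, gen l.1 = ⟨i, a⟩ ∧ ∃ g : G i,
    p = Quotient.mk _ g ∧ q = Quotient.mk _ (g * (if l.2 then a else a⁻¹))
  edge_rev := by
    rintro p y b q ⟨a, ha, g, rfl, rfl⟩
    refine ⟨a, ha, g * (if b then a else a⁻¹), rfl, ?_⟩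
    cases b <;> simp

/-- `Γ` is `G`-based: every path whose label represents `1` is closed. -/
def GBased (Γ : LabelledGraph X V) : Prop :=
  ∀ p s q, Γ.Reads p s q → wordVal φ gen s = 1 → p = q

/-- (Connected) precovers of the amalgam: connected `G`-based graphs all of whose
`X_i`-monochromatic components are covers of `G_i`. A single vertex without edges qualifies. -/
def IsPrecover (Γ : LabelledGraph X V) : Prop :=
  Γ.Connected ∧ GBased φ gen Γ ∧
    ∀ i p, HasColour gen Γ i p →
      ∃ S : Subgroup (G i), (component gen Γ i p).Isomorphic (relCayley gen i S)

/-- The `X_i`-monochromatic component `C` of `p` is the only monochromatic component of `Γ`. -/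
def UniqueComponent (Γ : LabelledGraph X V) (i : Fin 2) (p : V) : Prop :=
  ∀ j q, HasColour gen Γ j q → j = i ∧ q ∈ compVerts gen Γ i p

/-- The vertices `ϑ · a` with `a ∈ A` of the `X_i`-monochromatic component of `ϑ`. -/
def orbitA (Γ : LabelledGraph X V) (i : Fin 2) (t : V) : Set V :=
  {q | ∃ s, (colourPart gen Γ i).Reads t s q ∧
    wordVal φ gen s ∈ (Monoid.PushoutI.base φ).range}

/-- The `X_i`-monochromatic component `C` of `p` is redundant with respect to the vertex `v₀`.
In the second case `t` is a bichromatic vertex of `C` and `K = Lab(C, t)`. -/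
def RedundantWrt (Γ : LabelledGraph X V) (v₀ : V) (i : Fin 2) (p : V) : Prop :=
  (UniqueComponent gen Γ i p ∧ Lab φ gen (colourPart gen Γ i) p = {1}) ∨
  (¬ UniqueComponent gen Γ i p ∧ ∃ t ∈ compVerts gen Γ i p, Bichromatic gen Γ t ∧
    Lab φ gen (colourPart gen Γ i) t ⊆ (Monoid.PushoutI.base φ).range ∧
    {q ∈ compVerts gen Γ i p | Bichromatic gen Γ q} = orbitA φ gen Γ i t ∧
    (v₀ ∈ compVerts gen Γ i p →
      Bichromatic gen Γ v₀ ∧ Lab φ gen (colourPart gen Γ i) t = {1}))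

/-- Reduced precovers `(Γ, v₀)`: no monochromatic component is redundant with respect to `v₀`,
and if `Lab(C₀, v₀) ∩ A ≠ {1}` for a monochromatic component `C₀` through `v₀`, then `v₀` is
bichromatic. -/
def IsReducedPrecover (Γ : LabelledGraph X V) (v₀ : V) : Prop :=
  IsPrecover φ gen Γ ∧
  (∀ i p, HasColour gen Γ i p → ¬ RedundantWrt φ gen Γ v₀ i p) ∧
  (∀ i, HasColour gen Γ i v₀ →
    Lab φ gen (colourPart gen Γ i) v₀ ∩ (Monoid.PushoutI.base φ).range ≠ {1} →
    Bichromatic gen Γ v₀)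

/-- `(Γ, v₀)` is the subgroup graph `Γ(H)`: a finite reduced precover of the amalgam
with `Lab(Γ, v₀) = H`. -/
def IsSubgroupGraph (H : Subgroup (Monoid.PushoutI φ)) (Γ : LabelledGraph X V) (v₀ : V) : Prop :=
  Finite V ∧ IsReducedPrecover φ gen Γ v₀ ∧ Lab φ gen Γ v₀ = H

/-- The subgroup generated by a finite list of words. -/
def genSubgroup (hs : List (List (X × Bool))) : Subgroup (Monoid.PushoutI φ) :=
  Subgroup.closure {g | ∃ h ∈ hs, wordVal φ gen h = g}

end Amalgam

end AmalgamGraph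

/-!
Let `G` act on a set `Y`, and let a path with label `y` lead from `p` to `y⁻¹ • p`. For the cosets
of a subgroup `H` this is the graph of cosets, in which `Lab` at the coset of `1` is `H`, and a
union of monochromatic components is a pair of sets `P i ⊆ Y` such that `P i` is invariant under
the factor `G i` (`Invariant`). The proof works with such families; `familyGraph` turns a family
into a precover.

*Exponents* (`exists_pow_smul_eq`). An element `g` of infinite order is conjugate to one with a
cyclically reduced normal form: `g = u c u⁻¹` (`exists_conj_eq`). Suppose that `g ^ n` is in `H` and
that all elements of `H` can be read at the base point inside the family. A path inside the family
can be reduced inside it, because an element of the amalgamated subgroup `A` can be read in either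
colour; and by the normal form theorem two reduced paths with the same label pass through the same
points up to `A`. So the reduced form of `g ^ (n k)` is read inside the family for all `k`. Its
middle part consists of copies of `c`, which shows that the orbit of the point `u⁻¹ • p` under `c`
stays inside the family (`IsRed.readable_middle`). By the pigeonhole principle the period of this
orbit is at most the number of points of the family. An abstract precover with `Lab = H` maps to
the graph of cosets, which transfers the bound to it (`exists_pow_mem_le_card`).

*Existence* (`exists_isSubgroupGraph`). The components through the points reached by prefixes of the
generators form a finite family in which `H` can be read (`prefixFamily_supports`). Among all such
families take one with the least number of points. If a component is redundant, then the segments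
of paths through it have labels in `A` and can be rerouted through the other colour, so that the
component can be removed (`Supports.remove`). Hence the graph of a minimal family is reduced.

*The algorithm.* It suffices to decide membership in a finitely generated subgroup: the least
exponent is then found by a search up to an explicit bound, where elements of finite order are
covered by their being conjugate into a factor (`exists_pow_mem_lt`). If a word `s` is not in `H`,
take the finite family of the prefixes of the generators and of `s`, and a finite set `F` on which
`G` acts, with an `A`-equivariant map to `A`. Then the actions of both factors, which are defined on
parts of the family only, extend to the product of the family with `F` (`extAct`). In this finite
`G`-set the fibre over the base point is preserved by `H` but not by `s` (`exists_separates`).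
Conversely such a finite action proves that `s` is not in `H` (`Separates.notMem`). The actions are
tables of bounded size, encoded by the digits of one number, so membership is decided by a bounded
search, which is primitive recursive (`primrecPred_mem_genSubgroup`).
-/

namespace AmalgamGraph

open Monoid

set_option linter.unusedSectionVars false

/-! ### Reduced sequences of syllables -/

section NormalForms

universe u v w

variable {A : Type u} {G : Fin 2 → Type v} [Group A] [∀ i, Group (G i)]
  {φ : ∀ i, A →* G i} {Y : Type w} [MulAction (PushoutI φ) Y]

variable (φ) in
/-- The element of the amalgam represented by a syllable, that is, by an element of a factor. -/
def sylVal (g : Σ i, G i) : PushoutI φ := PushoutI.of g.1 g.2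

variable (φ) in
/-- The element of the amalgam represented by a sequence of syllables. -/
def listVal (L : List (Σ i, G i)) : PushoutI φ := (L.map (sylVal φ)).prod

@[simp] lemma listVal_nil : listVal φ ([] : List (Σ i, G i)) = 1 := rfl

@[simp] lemma listVal_cons (g : Σ i, G i) (L : List (Σ i, G i)) :
    listVal φ (g :: L) = sylVal φ g * listVal φ L := by simp [listVal]

@[simp] lemma listVal_append (L M : List (Σ i, G i)) :
    listVal φ (L ++ M) = listVal φ L * listVal φ M := by simp [listVal]

lemma sylVal_mul (i : Fin 2) (a b : G i) :
    sylVal φ ⟨i, a * b⟩ = sylVal φ ⟨i, a⟩ * sylVal φ ⟨i, b⟩ := by simp [sylVal]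

lemma sylVal_base (i : Fin 2) (a : A) : sylVal φ ⟨i, φ i a⟩ = PushoutI.base φ a :=
  PushoutI.of_apply_eq_base φ i a

lemma exists_listVal (g : PushoutI φ) : ∃ L, listVal φ L = g := by
  induction g using PushoutI.induction_on with
  | of i g => exact ⟨[⟨i, g⟩], by simp [sylVal]⟩
  | base a => exact ⟨[⟨0, φ 0 a⟩], by simp [sylVal_base]⟩
  | mul x y hx hy =>
    obtain ⟨L, rfl⟩ := hx
    obtain ⟨M, rfl⟩ := hy
    exact ⟨L ++ M, by simp⟩

variable (φ) in
/-- Reduced sequences: no syllable lies in the amalgamated subgroup, and consecutive syllables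
come from different factors. The empty sequence is reduced. -/
def IsRed (L : List (Σ i, G i)) : Prop :=
  (∀ g ∈ L, g.2 ∉ (φ g.1).range) ∧ L.IsChain (fun a b => a.1 ≠ b.1)

lemma IsRed.tail {g : Σ i, G i} {L : List (Σ i, G i)} (h : IsRed φ (g :: L)) : IsRed φ L :=
  ⟨fun x hx => h.1 x (List.mem_cons_of_mem _ hx), h.2.tail⟩

lemma IsRed.left {L M : List (Σ i, G i)} (h : IsRed φ (L ++ M)) : IsRed φ L :=
  ⟨fun x hx => h.1 x (List.mem_append_left _ hx), h.2.left_of_append⟩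

lemma isRed_cons {g : Σ i, G i} {L : List (Σ i, G i)} :
    IsRed φ (g :: L) ↔ g.2 ∉ (φ g.1).range ∧ (∀ k ∈ L.head?, g.1 ≠ k.1) ∧ IsRed φ L := by
  simp only [IsRed, List.mem_cons, forall_eq_or_imp, List.isChain_cons]
  tauto

/-- A reduced sequence stays reduced when its first syllable is replaced by another one of the
same colour outside the amalgamated subgroup. -/
lemma IsRed.replace_head {i : Fin 2} {a b : G i} {L : List (Σ i, G i)}
    (h : IsRed φ (⟨i, a⟩ :: L)) (hb : b ∉ (φ i).range) : IsRed φ (⟨i, b⟩ :: L) := by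
  rw [isRed_cons] at h ⊢
  exact ⟨hb, h.2.1, h.2.2⟩

lemma IsRed.base_mul_head {i : Fin 2} {b : G i} {L : List (Σ i, G i)} (a : A)
    (h : IsRed φ (⟨i, b⟩ :: L)) : IsRed φ (⟨i, φ i a * b⟩ :: L) := by
  refine h.replace_head fun hb => (isRed_cons.1 h).1 ?_
  exact (Subgroup.mul_mem_cancel_left _ (MonoidHom.mem_range.2 ⟨a, rfl⟩)).1 hb

/-- The normal form theorem: a nonempty reduced sequence represents an element outside the
amalgamated subgroup. -/
lemma IsRed.listVal_notMem_base (hφ : ∀ i, Function.Injective (φ i)) {L : List (Σ i, G i)}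
    (h : IsRed φ L) (hL : L ≠ []) : listVal φ L ∉ (PushoutI.base φ).range := by
  intro hm
  let W : CoprodI.Word G := ⟨L, fun l hl h1 => h.1 l hl (h1 ▸ one_mem _), h.2⟩
  have hW : PushoutI.Reduced φ W := h.1
  have := hW.eq_empty_of_mem_range hφ (by
    have : PushoutI.ofCoprodI (φ := φ) W.prod = listVal φ L := by
      simp only [W, CoprodI.Word.prod, listVal, map_list_prod, List.map_map]
      congr 1
    rwa [this])
  exact hL (congrArg CoprodI.Word.toList this)

lemma IsRed.listVal_ne_one (hφ : ∀ i, Function.Injective (φ i)) {L : List (Σ i, G i)}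
    (h : IsRed φ L) (hL : L ≠ []) : listVal φ L ≠ 1 :=
  fun h1 => h.listVal_notMem_base hφ hL (h1 ▸ one_mem _)

/-- The formally inverse sequence. -/
def invList (L : List (Σ i, G i)) : List (Σ i, G i) := (L.map fun g => ⟨g.1, g.2⁻¹⟩).reverse

@[simp] lemma length_invList (L : List (Σ i, G i)) : (invList L).length = L.length := by
  simp [invList]

lemma invList_append (L M : List (Σ i, G i)) : invList (L ++ M) = invList M ++ invList L := by
  simp [invList]

lemma listVal_invList (L : List (Σ i, G i)) : listVal φ (invList L) = (listVal φ L)⁻¹ := by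
  induction L with
  | nil => simp [invList]
  | cons g L ih =>
    rw [← List.singleton_append, invList_append, listVal_append, ih]
    simp [invList, sylVal]

lemma IsRed.invList {L : List (Σ i, G i)} (h : IsRed φ L) : IsRed φ (invList L) := by
  constructor
  · intro g hg
    simp only [AmalgamGraph.invList, List.mem_reverse, List.mem_map] at hg
    obtain ⟨x, hx, rfl⟩ := hg
    exact fun h1 => h.1 x hx (by simpa using h1)
  · rw [AmalgamGraph.invList, List.isChain_reverse, List.isChain_map]
    exact h.2.imp fun a b hab => hab.symm

/-- Two reduced sequences with the same value start with syllables of the same colour which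
differ by an element of the amalgamated subgroup. -/
lemma IsRed.head_eq (hφ : ∀ i, Function.Injective (φ i)) {l m : Σ i, G i}
    {L M : List (Σ i, G i)} (hl : IsRed φ (l :: L)) (hm : IsRed φ (m :: M))
    (h : listVal φ (l :: L) = listVal φ (m :: M)) :
    ∃ a : A, l = ⟨m.1, m.2 * φ m.1 a⟩ := by
  have inv_cons : ∀ x : Σ i, G i, AmalgamGraph.invList (x :: M)
      = AmalgamGraph.invList M ++ [⟨x.1, x.2⁻¹⟩] := fun x => by
    simp [AmalgamGraph.invList]
  by_cases hc : l.1 = m.1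
  · obtain ⟨i, x⟩ := l
    obtain ⟨j, z⟩ := m
    obtain rfl : i = j := hc
    by_cases hxz : z⁻¹ * x ∈ (φ i).range
    · obtain ⟨a, ha⟩ := hxz
      exact ⟨a, by simp [ha]⟩
    · -- Otherwise the product of the inverse of `M`, of `z⁻¹ * x` and of `L` is reduced.
      exfalso
      have hmz : IsRed φ (⟨i, x⁻¹ * z⟩ :: M) := hm.replace_head fun h1 => hxz (by
        have := inv_mem h1
        simpa using this)
      have h1 := hmz.invList
      rw [inv_cons] at h1
      have hr : IsRed φ (AmalgamGraph.invList M ++ ⟨i, z⁻¹ * x⟩ :: L) := by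
        have e : (x⁻¹ * z)⁻¹ = z⁻¹ * x := by group
        rw [e] at h1
        have h2 := hl.replace_head hxz
        have h3 := h1.2.append_overlap (l₂ := [⟨i, z⁻¹ * x⟩]) (l₃ := L) h2.2 (by simp)
        refine ⟨fun g hg => ?_, by simpa using h3⟩
        rcases List.mem_append.1 hg with hg | hg
        · exact h1.1 g (List.mem_append_left _ hg)
        · exact h2.1 g hg
      refine hr.listVal_ne_one hφ (by simp) ?_
      simp only [listVal_cons, listVal_append, listVal_invList, sylVal_mul] at h ⊢
      have e : sylVal φ ⟨i, z⁻¹⟩ = (sylVal φ ⟨i, z⟩)⁻¹ := by simp [sylVal]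
      rw [e, mul_assoc, h]
      group
  · exfalso
    have hr : IsRed φ (AmalgamGraph.invList (m :: M) ++ l :: L) := by
      refine ⟨fun g hg => ?_, ?_⟩
      · rcases List.mem_append.1 hg with hg | hg
        · exact hm.invList.1 g hg
        · exact hl.1 g hg
      · refine hm.invList.2.append hl.2 ?_
        rw [inv_cons]
        simpa using fun h1 => hc h1.symm
    refine hr.listVal_ne_one hφ (by simp) ?_
    rw [listVal_append, listVal_invList, h]
    group

/-! ### Readable sequences -/

/-- `Readable P y L`: the sequence `L` can be read from `y` inside the family `P`, where reading a
syllable `g` leads from `y` to `g⁻¹ • y`, and a syllable of colour `i` may be read at the points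
of `P i`. -/
def Readable (P : Fin 2 → Set Y) : Y → List (Σ i, G i) → Prop
  | _, [] => True
  | y, g :: L => y ∈ P g.1 ∧ Readable P ((sylVal φ g)⁻¹ • y) L

lemma readable_append {P : Fin 2 → Set Y} {y : Y} {L M : List (Σ i, G i)} :
    Readable (φ := φ) P y (L ++ M) ↔ Readable (φ := φ) P y L ∧
      Readable (φ := φ) P ((listVal φ L)⁻¹ • y) M := by
  induction L generalizing y with
  | nil => simp [Readable]
  | cons g L ih => simp [Readable, ih, mul_smul, and_assoc]

variable (φ) in
/-- Families `P` for which every `P i` is invariant under the factor `G i`. Inside a graph of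
cosets, such a family is a union of monochromatic components. -/
def Invariant (P : Fin 2 → Set Y) : Prop :=
  ∀ i (g : G i) y, y ∈ P i → sylVal φ ⟨i, g⟩ • y ∈ P i

lemma Invariant.inv {P : Fin 2 → Set Y} (hP : Invariant φ P) (g : Σ i, G i) {y : Y}
    (hy : y ∈ P g.1) : (sylVal φ g)⁻¹ • y ∈ P g.1 := by
  have := hP g.1 g.2⁻¹ y hy
  simpa [sylVal] using this

lemma Invariant.base {P : Fin 2 → Set Y} (hP : Invariant φ P) {i : Fin 2} (a : A) {y : Y}
    (hy : y ∈ P i) : PushoutI.base φ a • y ∈ P i := by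
  rw [← sylVal_base i]
  exact hP i _ y hy

/-- Left multiplication of a reduced sequence by a syllable changes at most its first two
syllables, and keeps it readable. -/
lemma IsRed.exists_mul_left {P : Fin 2 → Set Y} (hP : Invariant φ P) (s : Σ i, G i)
    {L : List (Σ i, G i)} (hL : IsRed φ L) :
    (L.length ≤ 1 ∧ sylVal φ s * listVal φ L ∈ (PushoutI.base φ).range) ∨
    ∃ M, IsRed φ M ∧ listVal φ M = sylVal φ s * listVal φ L ∧ L.drop 2 <:+ M ∧
      ∀ y, y ∈ P s.1 → Readable (φ := φ) P ((sylVal φ s)⁻¹ • y) L → Readable (φ := φ) P y M := by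
  obtain ⟨i, x⟩ := s
  -- An element of the amalgamated subgroup is absorbed by the first syllable.
  have absorb : ∀ (a : A) (k : Σ i, G i) (M : List (Σ i, G i)), IsRed φ (k :: M) →
      IsRed φ (⟨k.1, φ k.1 a * k.2⟩ :: M) ∧
      listVal φ (⟨k.1, φ k.1 a * k.2⟩ :: M) = PushoutI.base φ a * listVal φ (k :: M) ∧
      ∀ y, Readable (φ := φ) P ((PushoutI.base φ a)⁻¹ • y) (k :: M) →
        Readable (φ := φ) P y (⟨k.1, φ k.1 a * k.2⟩ :: M) := by
    rintro a ⟨k, z⟩ M h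
    refine ⟨h.base_mul_head a, ?_, fun y hy => ⟨?_, ?_⟩⟩
    · simp [sylVal_mul, sylVal_base, mul_assoc]
    · have := hP.base a hy.1
      simpa using this
    · have := hy.2
      simpa [sylVal_mul, sylVal_base, mul_smul] using this
  by_cases hx : x ∈ (φ i).range
  · obtain ⟨a, rfl⟩ := hx
    match L, hL with
    | [], _ => exact Or.inl ⟨by simp, by simp [sylVal_base]⟩
    | k :: L, hL =>
      obtain ⟨h1, h2, h3⟩ := absorb a k L hL
      refine Or.inr ⟨_, h1, by rw [h2, sylVal_base], ?_, fun y _ hr => h3 y ?_⟩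
      · exact (List.drop_suffix 1 L).trans (List.suffix_cons _ _)
      · rwa [sylVal_base] at hr
  match L, hL with
  | [], _ =>
    exact Or.inr ⟨[⟨i, x⟩], isRed_cons.2 ⟨hx, by simp, by simp [IsRed]⟩, by simp, by simp,
      fun y hy _ => ⟨hy, trivial⟩⟩
  | ⟨k, z⟩ :: L, hL =>
    by_cases hk : i = k
    · subst hk
      by_cases hxz : x * z ∈ (φ i).range
      · obtain ⟨a, ha⟩ := hxz
        have key : sylVal φ ⟨i, x⟩ * sylVal φ ⟨i, z⟩ = PushoutI.base φ a := by
          rw [← sylVal_mul, ← ha, sylVal_base]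
        match L, hL with
        | [], _ => exact Or.inl ⟨by simp, by simp [key]⟩
        | m :: L, hL =>
          obtain ⟨h1, h2, h3⟩ := absorb a m L hL.tail
          refine Or.inr ⟨_, h1, by rw [h2, ← key]; simp [mul_assoc], ?_,
            fun y _ hr => h3 y ?_⟩
          · exact List.suffix_cons _ _
          · have := hr.2
            rwa [← mul_smul, ← mul_inv_rev, key] at this
      · refine Or.inr ⟨⟨i, x * z⟩ :: L, hL.replace_head hxz, by simp [sylVal_mul, mul_assoc], ?_,
          fun y hy hr => ⟨hy, ?_⟩⟩
        · exact (List.drop_suffix 1 L).trans (List.suffix_cons _ _)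
        · have := hr.2
          rwa [← mul_smul, ← mul_inv_rev, ← sylVal_mul] at this
    · refine Or.inr ⟨⟨i, x⟩ :: ⟨k, z⟩ :: L, isRed_cons.2 ⟨hx, by simpa using hk, hL⟩, by simp, ?_,
        fun y hy hr => ⟨hy, hr⟩⟩
      exact ((List.drop_suffix 1 L).trans (List.suffix_cons _ _)).trans (List.suffix_cons _ _)

/-- A readable sequence can be reduced inside the family, unless it represents an element of the
amalgamated subgroup. -/
lemma exists_isRed_readable {P : Fin 2 → Set Y} (hP : Invariant φ P) (L : List (Σ i, G i)) {y : Y}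
    (hL : Readable (φ := φ) P y L) :
    listVal φ L ∈ (PushoutI.base φ).range ∨
    ∃ M, IsRed φ M ∧ listVal φ M = listVal φ L ∧ Readable (φ := φ) P y M := by
  induction L generalizing y with
  | nil => exact Or.inl (by simp)
  | cons g L ih =>
    rcases ih hL.2 with ⟨a, ha⟩ | ⟨M, h1, h2, h3⟩
    · have hr : IsRed φ ([] : List (Σ i, G i)) := by simp [IsRed]
      rcases hr.exists_mul_left hP ⟨g.1, g.2 * φ g.1 a⟩ with ⟨_, h⟩ | ⟨M, h1, h2, -, h3⟩
      · left
        simpa [sylVal_mul, sylVal_base, ← ha] using h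
      · exact Or.inr ⟨M, h1, by simpa [sylVal_mul, sylVal_base, ← ha] using h2,
          h3 y hL.1 trivial⟩
    · rcases h1.exists_mul_left hP g with ⟨_, h⟩ | ⟨N, h4, h5, -, h6⟩
      · left
        rwa [listVal_cons, ← h2]
      · exact Or.inr ⟨N, h4, by rw [h5, h2, listVal_cons], h6 y hL.1 h3⟩

/-- If some reduced sequence is readable, then so is every reduced sequence with the same value,
because both differ by elements of the amalgamated subgroup only. -/
lemma IsRed.readable_of_eq (hφ : ∀ i, Function.Injective (φ i)) {P : Fin 2 → Set Y}
    (hP : Invariant φ P) {L M : List (Σ i, G i)} (hL : IsRed φ L) (hM : IsRed φ M)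
    (h : listVal φ L = listVal φ M) {y : Y} (hy : Readable (φ := φ) P y M) :
    Readable (φ := φ) P y L := by
  induction L generalizing M y with
  | nil => trivial
  | cons l L ih =>
    match M, hM with
    | [], _ => exact absurd h (hL.listVal_ne_one hφ (by simp))
    | m :: M, hM =>
      obtain ⟨a, rfl⟩ := hL.head_eq hφ hM h
      refine ⟨hy.1, ?_⟩
      have h' : listVal φ L = (PushoutI.base φ a)⁻¹ * listVal φ M := by
        simp only [listVal_cons, sylVal_mul, sylVal_base, mul_assoc, Sigma.eta] at h
        exact eq_inv_mul_of_mul_eq (mul_left_cancel h)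
      match M, hM with
      | [], _ =>
        match L, hL with
        | [], _ => trivial
        | l :: L, hL =>
          refine absurd ?_ (hL.tail.listVal_notMem_base hφ (by simp))
          rw [h']
          exact ⟨a⁻¹, by simp⟩
      | ⟨k, z⟩ :: M, hM =>
        refine ih hL.tail (hM.tail.base_mul_head a⁻¹) ?_ ⟨?_, ?_⟩
        · rw [h']
          simp [sylVal_mul, sylVal_base, mul_assoc, -map_inv]
          simp
        · have := hP.base a⁻¹ hy.2.1
          simpa [sylVal_mul, sylVal_base, mul_smul] using this
        · have := hy.2.2
          have e : sylVal φ ⟨k, φ k a⁻¹ * z⟩ = (PushoutI.base φ a)⁻¹ * sylVal φ ⟨k, z⟩ := by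
            rw [sylVal_mul, sylVal_base, map_inv]
          rw [e]
          simpa [sylVal_mul, sylVal_base, mul_smul] using this

lemma IsRed.exists_listVal_mul_left {L : List (Σ i, G i)} (hL : IsRed φ L) (U : List (Σ i, G i))
    (h : 2 * U.length ≤ L.length) :
    ∃ M, IsRed φ M ∧ listVal φ M = listVal φ U * listVal φ L ∧ L.drop (2 * U.length) <:+ M := by
  induction U with
  | nil => exact ⟨L, hL, by simp, by simp⟩
  | cons s U ih =>
    rw [List.length_cons] at h ⊢
    obtain ⟨M, h1, h2, K, h3⟩ := ih (by omega)
    have hlen : 2 ≤ M.length := by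
      rw [← h3, List.length_append, List.length_drop]
      omega
    have hP : Invariant φ (fun _ => (Set.univ : Set (PushoutI φ))) := fun _ _ _ _ => trivial
    rcases h1.exists_mul_left hP s with ⟨h, _⟩ | ⟨N, h4, h5, h6, -⟩
    · omega
    · refine ⟨N, h4, by rw [h5, h2, listVal_cons, mul_assoc], List.IsSuffix.trans ?_ h6⟩
      rw [← h3, List.drop_append, mul_add, ← List.drop_drop]
      refine List.IsSuffix.trans ?_ (List.suffix_append _ _)
      obtain ⟨r, hr⟩ : ∃ r, 2 * 1 = (2 - K.length) + r := ⟨2 - (2 - K.length), by omega⟩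
      rw [hr, ← List.drop_drop]
      exact List.drop_suffix _ _

lemma IsRed.exists_listVal_mul_right {L : List (Σ i, G i)} (hL : IsRed φ L) (U : List (Σ i, G i))
    (h : 2 * U.length ≤ L.length) :
    ∃ M, IsRed φ M ∧ listVal φ M = listVal φ L * listVal φ U ∧
      L.take (L.length - 2 * U.length) <+: M := by
  obtain ⟨M, h1, h2, K, h3⟩ := hL.invList.exists_listVal_mul_left (AmalgamGraph.invList U)
    (by simpa using h)
  refine ⟨AmalgamGraph.invList M, h1.invList, ?_, AmalgamGraph.invList K, ?_⟩
  · rw [listVal_invList, h2, listVal_invList, listVal_invList]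
    group
  · rw [← h3, invList_append]
    congr 1
    simp [AmalgamGraph.invList, List.drop_reverse, List.map_take, Function.comp_def]

/-- If a product `U * L * V` is readable and `L` is reduced and long, then the middle part of `L`
survives all cancellations and is therefore read inside the family. -/
lemma IsRed.readable_middle (hφ : ∀ i, Function.Injective (φ i)) {P : Fin 2 → Set Y}
    (hP : Invariant φ P) {L₁ L₂ L₃ U V W : List (Σ i, G i)} (hL : IsRed φ (L₁ ++ (L₂ ++ L₃)))
    (h₂ : L₂ ≠ []) (h₁ : 2 * U.length ≤ L₁.length) (h₃ : 2 * V.length ≤ L₃.length) {y : Y}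
    (hW : Readable (φ := φ) P y W)
    (h : listVal φ W = listVal φ U * listVal φ (L₁ ++ (L₂ ++ L₃)) * listVal φ V) :
    Readable (φ := φ) P ((listVal φ U * listVal φ L₁)⁻¹ • y) L₂ := by
  obtain ⟨M, m1, m2, K, m3⟩ := hL.exists_listVal_mul_left U (by simp; omega)
  rw [List.drop_append_of_le_length h₁] at m3
  obtain ⟨M', r1, r2, R, r3⟩ := m1.exists_listVal_mul_right V (by
    rw [← m3]; simp; omega)
  have hM' : M' = (K ++ L₁.drop (2 * U.length)) ++ (L₂ ++
      (L₃.take (L₃.length - 2 * V.length) ++ R)) := by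
    rw [← r3, ← m3]
    have : ((K ++ (List.drop (2 * U.length) L₁ ++ (L₂ ++ L₃))).length - 2 * V.length)
        = K.length + ((List.drop (2 * U.length) L₁).length + (L₂.length +
          (L₃.length - 2 * V.length))) := by
      simp only [List.length_append]
      omega
    rw [this, List.take_length_add_append, List.take_length_add_append,
      List.take_length_add_append]
    simp
  have hval : listVal φ M' = listVal φ W := by rw [r2, m2, h]
  have hne : M' ≠ [] := by simp [hM', h₂]
  have hread : Readable (φ := φ) P y M' := by
    rcases exists_isRed_readable hP W hW with h0 | ⟨N, n1, n2, n3⟩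
    · exact absurd (hval ▸ h0) (r1.listVal_notMem_base hφ hne)
    · exact r1.readable_of_eq hφ hP n1 (hval.trans n2.symm) n3
  rw [hM', readable_append, readable_append (L := L₂)] at hread
  have hK : listVal φ (K ++ L₁.drop (2 * U.length)) = listVal φ U * listVal φ L₁ := by
    have h5 : listVal φ (K ++ L₁.drop (2 * U.length)) * listVal φ (L₂ ++ L₃)
        = listVal φ U * listVal φ L₁ * listVal φ (L₂ ++ L₃) := by
      rw [← listVal_append, List.append_assoc, m3, m2, listVal_append, mul_assoc]
    exact mul_right_cancel h5
  rw [← hK]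
  exact hread.2.1

/-! ### Cyclic reduction -/

/-- Every element is conjugate to an element of a factor or to one represented by a cyclically
reduced sequence: take a shortest sequence representing a conjugate. -/
lemma exists_conj_eq (g : PushoutI φ) :
    (∃ (u : PushoutI φ) (s : Σ i, G i), g = u * sylVal φ s * u⁻¹) ∨
    ∃ (u : PushoutI φ) (L : List (Σ i, G i)), L ≠ [] ∧ IsRed φ (L ++ L) ∧
      g = u * listVal φ L * u⁻¹ := by
  classical
  have hex : ∃ n, ∃ (u : PushoutI φ) (L : List (Σ i, G i)), L.length = n ∧
      g = u * listVal φ L * u⁻¹ := by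
    obtain ⟨L, hL⟩ := exists_listVal g
    exact ⟨_, 1, L, rfl, by simp [hL]⟩
  obtain ⟨u, L, hlen, hg⟩ := Nat.find_spec hex
  have hmin : ∀ (u' : PushoutI φ) (L' : List (Σ i, G i)), g = u' * listVal φ L' * u'⁻¹ →
      L.length ≤ L'.length := fun u' L' h => hlen ▸ Nat.find_min' hex ⟨u', L', rfl, h⟩
  match L, hg, hmin with
  | [], hg, _ => exact Or.inl ⟨u, ⟨0, 1⟩, by simpa [sylVal] using hg⟩
  | [s], hg, _ => exact Or.inl ⟨u, s, by simpa using hg⟩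
  | s :: t :: L, hg, hmin =>
    right
    set M := s :: t :: L with hM
    have hM2 : 2 ≤ M.length := by simp [hM]
    have rot : ∀ S T : List (Σ i, G i), M = S ++ T →
        g = (u * listVal φ S) * listVal φ (T ++ S) * (u * listVal φ S)⁻¹ := by
      intro S T h
      rw [hg, h]
      simp only [listVal_append]
      group
    have key : ∀ (u' : PushoutI φ) (a b : Σ i, G i) (R : List (Σ i, G i)),
        g = u' * listVal φ (a :: b :: R) * u'⁻¹ → R.length + 2 = M.length →
        a.2 ∉ (φ a.1).range ∧ a.1 ≠ b.1 := by
      rintro u' ⟨i, x⟩ ⟨j, z⟩ R h hl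
      constructor
      · rintro ⟨c, hc⟩
        have := hmin u' (⟨j, φ j c * z⟩ :: R) (by
          rw [h]
          dsimp only at hc
          simp [sylVal_mul, sylVal_base, ← hc, mul_assoc])
        simp at this
        omega
      · rintro hij
        obtain rfl : i = j := hij
        have := hmin u' (⟨i, x * z⟩ :: R) (by rw [h]; simp [sylVal_mul, mul_assoc])
        simp at this
        omega
    have hmem : ∀ x ∈ M, x.2 ∉ (φ x.1).range := by
      intro x hx
      obtain ⟨S, T, hST⟩ := List.append_of_mem hx
      have hr := rot S (x :: T) hST
      have hl : (T ++ S).length + 1 = M.length := by simp [hST]; omega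
      rw [List.cons_append] at hr
      match hTS : T ++ S with
      | [] => simp [hTS] at hl; omega
      | b :: R =>
        rw [hTS] at hr
        exact (key _ x b R hr (by simp [hTS] at hl; omega)).1
    have hchain : M.IsChain (fun a b => a.1 ≠ b.1) := by
      rw [List.isChain_iff_forall_rel_of_append_cons_cons]
      intro a b S T h
      exact (key _ a b (T ++ S) (rot S _ h) (by simp [h]; omega)).2
    refine ⟨u, M, by simp [hM], ⟨fun x hx => hmem x (by simpa using hx), ?_⟩, hg⟩
    refine hchain.append hchain ?_
    intro x hx y hy
    rw [hM, List.head?_cons, Option.mem_some_iff] at hy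
    subst hy
    rw [Option.mem_def, List.getLast?_eq_some_iff] at hx
    obtain ⟨S, hS⟩ := hx
    match S with
    | [] => simp [hS] at hM2
    | s' :: S =>
      obtain rfl : s = s' := by
        rw [hM] at hS
        exact (List.cons.inj hS).1
      exact (key _ x s S (rot (s :: S) [x] hS) (by simp [hS])).2

/-- The `k`-th power of a sequence. -/
def powList {α : Type*} (L : List α) (k : ℕ) : List α := (List.replicate k L).flatten

lemma powList_succ {α : Type*} (L : List α) (k : ℕ) : powList L (k + 1) = L ++ powList L k := by
  simp [powList, List.replicate_succ]

lemma powList_add {α : Type*} (L : List α) (k l : ℕ) :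
    powList L (k + l) = powList L k ++ powList L l := by
  rw [powList, List.replicate_add, List.flatten_append, powList, powList]

lemma listVal_powList (L : List (Σ i, G i)) (k : ℕ) :
    listVal φ (powList L k) = listVal φ L ^ k := by
  induction k with
  | zero => simp [powList]
  | succ k ih => rw [powList_succ, listVal_append, ih, pow_succ']

lemma le_length_powList {α : Type*} {L : List α} (hL : L ≠ []) (k : ℕ) :
    k ≤ (powList L k).length := by
  have := List.length_pos_of_ne_nil hL
  simp only [powList, List.length_flatten, List.map_replicate, List.sum_replicate, smul_eq_mul]
  exact Nat.le_mul_of_pos_right _ this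

lemma IsRed.powList {L : List (Σ i, G i)} (hL : L ≠ []) (h : IsRed φ (L ++ L)) (k : ℕ) :
    IsRed φ (powList L k) := by
  suffices h' : (L ++ AmalgamGraph.powList L k).IsChain (fun a b => a.1 ≠ b.1) by
    refine ⟨fun g hg => ?_, h'.right_of_append⟩
    simp only [AmalgamGraph.powList, List.mem_flatten, List.mem_replicate] at hg
    obtain ⟨M, ⟨_, rfl⟩, hg⟩ := hg
    exact h.left.1 g hg
  induction k with
  | zero => simpa [AmalgamGraph.powList] using h.left.2
  | succ k ih =>
    rw [powList_succ, ← List.append_assoc]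
    exact h.2.append_overlap ih hL

/-- Elements of finite order are conjugate into a factor. -/
lemma exists_conj_of_isOfFinOrder (hφ : ∀ i, Function.Injective (φ i)) {g : PushoutI φ}
    (hg : IsOfFinOrder g) : ∃ (u : PushoutI φ) (s : Σ i, G i), g = u * sylVal φ s * u⁻¹ := by
  rcases exists_conj_eq g with h | ⟨u, L, hL, hr, rfl⟩
  · exact h
  · exfalso
    obtain ⟨n, hn, h1⟩ := isOfFinOrder_iff_pow_eq_one.1 hg
    rw [conj_pow, conj_eq_one_iff, ← listVal_powList] at h1
    refine (IsRed.powList hL hr n).listVal_ne_one hφ ?_ h1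
    have := le_length_powList hL n
    intro h0
    rw [h0] at this
    simp at this
    omega

end NormalForms

/-! ### Bounding exponents by the size of a family -/

section Exponents

universe u v w

variable {A : Type u} {G : Fin 2 → Type v} [Group A] [∀ i, Group (G i)]
  {φ : ∀ i, A →* G i} {Y : Type w} [MulAction (PushoutI φ) Y]

lemma smul_one_coset_eq_iff {K : Type*} [Group K] (H : Subgroup K) (h : K) :
    h • ((1 : K) : K ⧸ H) = ((1 : K) : K ⧸ H) ↔ h ∈ H := by
  have : h • ((1 : K) : K ⧸ H) = ((h * 1 : K) : K ⧸ H) := rfl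
  rw [this, eq_comm, QuotientGroup.eq]
  simp

lemma conj_sylVal_pow_card [∀ i, Finite (G i)] (u : PushoutI φ) (s : Σ i, G i) :
    (u * sylVal φ s * u⁻¹) ^ Nat.card (G s.1) = 1 := by
  rw [conj_pow, sylVal, ← map_pow, pow_card_eq_one']
  simp

/-- If all elements of the stabilizer of `y` are readable in a finite family contained in `Z`,
then the orbit of a conjugate of `y` under the cyclically reduced part of `g` stays in `Z`, so
that its period is at most the cardinality of `Z`. -/
theorem exists_pow_smul_eq [∀ i, Finite (G i)] (hφ : ∀ i, Function.Injective (φ i))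
    {P : Fin 2 → Set Y} (hP : Invariant φ P) {Z : Set Y} (hZ : Z.Finite) (hPZ : ∀ i, P i ⊆ Z)
    {y : Y} (hy : ∀ h : PushoutI φ, h • y = y → ∃ W, listVal φ W = h ∧ Readable (φ := φ) P y W)
    {g : PushoutI φ} (hg : ¬ IsOfFinOrder g) {n : ℕ} (hn : 1 ≤ n) (hgn : g ^ n • y = y) :
    ∃ z, 1 ≤ z ∧ z ≤ Z.ncard ∧ g ^ z • y = y := by
  classical
  rcases exists_conj_eq g with ⟨u, s, rfl⟩ | ⟨u, L, hL, hr, rfl⟩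
  · exact absurd (isOfFinOrder_iff_pow_eq_one.2 ⟨_, Nat.card_pos, conj_sylVal_pow_card u s⟩) hg
  obtain ⟨U, rfl⟩ := exists_listVal u
  have hpow : ∀ t, (listVal φ U * listVal φ L * (listVal φ U)⁻¹) ^ (n * t) • y = y := by
    intro t
    rw [pow_mul]
    induction t with
    | zero => simp
    | succ t ih => rw [pow_succ, mul_smul, hgn, ih]
  have hmem : ∀ j, (listVal φ U * listVal φ L ^ j)⁻¹ • y ∈ Z := by
    intro j
    -- The exponents `a` and `b` are large enough for `U` and its inverse not to reach the middle.
    set a := j + n * (2 * U.length) with ha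
    set b := n * (a + 1 + 2 * U.length) - (a + 1) with hb
    have hle : a + 1 + 2 * U.length ≤ n * (a + 1 + 2 * U.length) := Nat.le_mul_of_pos_left _ hn
    have hab : a + (1 + b) = n * (a + 1 + 2 * U.length) := by omega
    obtain ⟨W, hW, hWr⟩ := hy _ (hpow (a + 1 + 2 * U.length))
    have h1L : powList L 1 = L := by simp [powList]
    have hcat : powList L (a + (1 + b)) = powList L a ++ (L ++ powList L b) := by
      rw [powList_add _ a, powList_add _ 1, h1L]
    have hred : IsRed φ (powList L a ++ (L ++ powList L b)) := by
      rw [← hcat]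
      exact IsRed.powList hL hr _
    have hmid := hred.readable_middle hφ hP (U := U) (V := invList U) (W := W) (y := y) hL
      (le_trans (by rw [ha]; exact le_add_left (Nat.le_mul_of_pos_left _ hn))
        (le_length_powList hL a))
      (le_trans (by rw [length_invList]; omega) (le_length_powList hL b)) hWr (by
        rw [hW, ← hcat, hab, conj_pow, listVal_invList, listVal_powList])
    obtain ⟨s, L', rfl⟩ := List.exists_cons_of_ne_nil hL
    have hin := hPZ _ hmid.1
    rw [listVal_powList] at hin
    have e : listVal φ U * listVal φ (s :: L') ^ a =
        (listVal φ U * listVal φ (s :: L') * (listVal φ U)⁻¹) ^ (n * (2 * U.length)) *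
          (listVal φ U * listVal φ (s :: L') ^ j) := by
      rw [conj_pow, ha, add_comm, pow_add]
      group
    rw [e, mul_inv_rev, mul_smul, inv_smul_eq_iff.2 (hpow _).symm] at hin
    exact hin
  obtain ⟨i, hi, j, hj, hij, he⟩ := Finset.exists_ne_map_eq_of_card_lt_of_maps_to
    (s := Finset.range (Z.ncard + 1)) (t := hZ.toFinset)
    (f := fun j => (listVal φ U * listVal φ L ^ j)⁻¹ • y)
    (by rw [Finset.card_range, Set.ncard_eq_toFinset_card Z hZ]; omega)
    (fun j _ => by simpa using hmem j)
  rw [Finset.mem_range] at hi hj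
  wlog hlt : i < j generalizing i j
  · exact this j hj i hi hij.symm he.symm (by omega)
  refine ⟨j - i, by omega, by omega, ?_⟩
  rw [eq_inv_smul_iff, ← mul_smul] at he
  have e : listVal φ U * listVal φ L ^ j * (listVal φ U * listVal φ L ^ i)⁻¹ =
      (listVal φ U * listVal φ L * (listVal φ U)⁻¹) ^ (j - i) := by
    obtain ⟨k, rfl⟩ := Nat.exists_eq_add_of_lt hlt
    have : i + k + 1 - i = k + 1 := by omega
    rw [this, conj_pow, add_assoc, add_comm, pow_add]
    group
  rwa [e] at he

end Exponents

/-! ### Words and paths -/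

section Graphs

universe u v w x y

variable {A : Type u} {G : Fin 2 → Type v} [Group A] [∀ i, Group (G i)]
  {φ : ∀ i, A →* G i} {X : Type x} {gen : X → Σ i, G i} {V : Type w}

variable (gen) in
/-- The syllable given by a letter. -/
def letterSyl (l : X × Bool) : Σ i, G i :=
  ⟨(gen l.1).1, if l.2 then (gen l.1).2 else (gen l.1).2⁻¹⟩

@[simp] lemma letterSyl_fst (l : X × Bool) : (letterSyl gen l).1 = (gen l.1).1 := rfl

lemma sylVal_letterSyl (l : X × Bool) : sylVal φ (letterSyl gen l) = letterVal φ gen l := by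
  rcases l with ⟨x, _ | _⟩
  · exact map_inv _ _
  · rfl

lemma letterVal_flip (x : X) (b : Bool) : letterVal φ gen (x, !b) = (letterVal φ gen (x, b))⁻¹ := by
  cases b <;> simp [letterVal]

lemma listVal_map_letterSyl (s : List (X × Bool)) :
    listVal φ (s.map (letterSyl gen)) = wordVal φ gen s := by
  simp [listVal, wordVal, Function.comp_def, sylVal_letterSyl]

@[simp] lemma wordVal_nil : wordVal φ gen [] = 1 := rfl

@[simp] lemma wordVal_cons (l : X × Bool) (s : List (X × Bool)) :
    wordVal φ gen (l :: s) = letterVal φ gen l * wordVal φ gen s := by simp [wordVal]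

@[simp] lemma wordVal_append (s t : List (X × Bool)) :
    wordVal φ gen (s ++ t) = wordVal φ gen s * wordVal φ gen t := by simp [wordVal]

/-- The formal inverse of a word. -/
def invWord (s : List (X × Bool)) : List (X × Bool) := (s.map fun l => (l.1, !l.2)).reverse

lemma invWord_cons (l : X × Bool) (s : List (X × Bool)) :
    invWord (l :: s) = invWord s ++ [(l.1, !l.2)] := by simp [invWord]

lemma wordVal_invWord (s : List (X × Bool)) :
    wordVal φ gen (invWord s) = (wordVal φ gen s)⁻¹ := by
  induction s with
  | nil => simp [invWord]
  | cons l s ih =>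
    rw [invWord_cons, wordVal_append, ih]
    simp [letterVal_flip]

lemma exists_word_of_factor
    (hgen : ∀ i, Subgroup.closure {a : G i | (⟨i, a⟩ : Σ i, G i) ∈ Set.range gen} = ⊤)
    (i : Fin 2) (a : G i) :
    ∃ s : List (X × Bool), (∀ l ∈ s, (gen l.1).1 = i) ∧ wordVal φ gen s = sylVal φ ⟨i, a⟩ := by
  have ha : a ∈ Subgroup.closure {a : G i | (⟨i, a⟩ : Σ i, G i) ∈ Set.range gen} := by
    rw [hgen]; trivial
  induction ha using Subgroup.closure_induction with
  | mem a ha =>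
    obtain ⟨x, hx⟩ := ha
    exact ⟨[(x, true)], by simp [hx], by
      rw [← hx]
      simp [letterVal, sylVal]⟩
  | one => exact ⟨[], by simp, by simp [sylVal]⟩
  | mul a b _ _ ha hb =>
    obtain ⟨s, hs, hs'⟩ := ha
    obtain ⟨t, ht, ht'⟩ := hb
    refine ⟨s ++ t, fun l hl => ?_, by rw [wordVal_append, hs', ht', sylVal_mul]⟩
    exact (List.mem_append.1 hl).elim (hs l) (ht l)
  | inv a _ ha =>
    obtain ⟨s, hs, hs'⟩ := ha
    refine ⟨invWord s, fun l hl => ?_, by rw [wordVal_invWord, hs']; simp [sylVal]⟩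
    simp only [invWord, List.mem_reverse, List.mem_map] at hl
    obtain ⟨k, hk, rfl⟩ := hl
    exact hs k hk

lemma exists_word
    (hgen : ∀ i, Subgroup.closure {a : G i | (⟨i, a⟩ : Σ i, G i) ∈ Set.range gen} = ⊤)
    (g : PushoutI φ) : ∃ s : List (X × Bool), wordVal φ gen s = g := by
  obtain ⟨L, rfl⟩ := exists_listVal g
  induction L with
  | nil => exact ⟨[], rfl⟩
  | cons a L ih =>
    obtain ⟨s, -, hs⟩ := exists_word_of_factor (φ := φ) hgen a.1 a.2
    obtain ⟨t, ht⟩ := ih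
    exact ⟨s ++ t, by simp [hs, ht]⟩

namespace LabelledGraph

variable {Γ : LabelledGraph X V}

lemma Reads.append {p q r : V} {s t : List (X × Bool)} (h : Γ.Reads p s q) (h' : Γ.Reads q t r) :
    Γ.Reads p (s ++ t) r := by
  induction h with
  | nil => exact h'
  | cons e _ ih => exact .cons e (ih h')

lemma Reads.inv {p q : V} {s : List (X × Bool)} (h : Γ.Reads p s q) :
    Γ.Reads q (invWord s) p := by
  induction h with
  | nil => exact .nil _
  | @cons p q r l s e _ ih =>
    rw [invWord_cons]
    exact ih.append (.cons (Γ.edge_rev _ _ _ _ e) (.nil _))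

lemma Reads.of_colourPart {i : Fin 2} {p q : V} {s : List (X × Bool)}
    (h : (colourPart gen Γ i).Reads p s q) : Γ.Reads p s q := by
  induction h with
  | nil => exact .nil _
  | cons e _ ih => exact .cons e.1 ih

end LabelledGraph

open LabelledGraph

/-- A graph in which all letters of colour `i` can be read at every vertex with an edge of
colour `i`. -/
def ColourComplete (gen : X → Σ i, G i) (Γ : LabelledGraph X V) (i : Fin 2) : Prop :=
  ∀ p, HasColour gen Γ i p → ∀ l, (gen l.1).1 = i → ∃ q, Γ.edge p l q

lemma ColourComplete.exists_reads {Γ : LabelledGraph X V} {i : Fin 2}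
    (hΓ : ColourComplete gen Γ i) {s : List (X × Bool)} (hs : ∀ l ∈ s, (gen l.1).1 = i) {p : V}
    (hp : HasColour gen Γ i p) :
    ∃ q, (colourPart gen Γ i).Reads p s q ∧ HasColour gen Γ i q := by
  induction s generalizing p with
  | nil => exact ⟨p, .nil _, hp⟩
  | cons l s ih =>
    have hl := hs l (by simp)
    obtain ⟨q, hq⟩ := hΓ p hp l hl
    obtain ⟨r, hr, hr'⟩ := ih (fun l h => hs l (by simp [h]))
      (p := q) ⟨_, p, Γ.edge_rev _ _ _ _ hq, hl⟩
    exact ⟨r, .cons ⟨hq, hl⟩ hr, hr'⟩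

lemma IsPrecover.colourComplete {Γ : LabelledGraph X V} (hΓ : IsPrecover φ gen Γ) (i : Fin 2) :
    ColourComplete gen Γ i := by
  intro p hp l hl
  obtain ⟨S, f, hf⟩ := hΓ.2.2 i p hp
  obtain ⟨g, hg⟩ := Quotient.exists_rep (f ⟨p, [], .nil _⟩)
  obtain ⟨a, ha⟩ : ∃ a : G i, gen l.1 = ⟨i, a⟩ := by
    subst hl
    exact ⟨(gen l.1).2, rfl⟩
  have he : (relCayley gen i S).edge (f ⟨p, [], .nil _⟩) l
      (f (f.symm (Quotient.mk _ (g * (if l.2 then a else a⁻¹))))) :=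
    ⟨a, ha, g, hg.symm, by simp⟩
  exact ⟨_, ((hf _ _ _).2 he).1⟩

/-- The bound on exponents: a precover with `Lab(Γ, v₀) = H` maps to the graph of cosets of `H`,
and its image is a family in which all elements of `H` are readable. -/
theorem exists_pow_mem_le_card [∀ i, Finite (G i)] (hφ : ∀ i, Function.Injective (φ i))
    (hgen : ∀ i, Subgroup.closure {a : G i | (⟨i, a⟩ : Σ i, G i) ∈ Set.range gen} = ⊤)
    {H : Subgroup (PushoutI φ)} {Γ : LabelledGraph X V} [Finite V] {v₀ : V}
    (hΓ : IsPrecover φ gen Γ) (hH : Lab φ gen Γ v₀ = H)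
    {g : PushoutI φ} (hg : ¬ IsOfFinOrder g) {n : ℕ} (hn : 1 ≤ n) (hgn : g ^ n ∈ H) :
    ∃ z, 1 ≤ z ∧ z ≤ Nat.card V ∧ g ^ z ∈ H := by
  choose path hpath using hΓ.1.2 v₀
  let y₀ : PushoutI φ ⧸ H := (1 : PushoutI φ)
  have hstab : ∀ h : PushoutI φ, h • y₀ = y₀ ↔ h ∈ H := smul_one_coset_eq_iff H
  let ι : V → PushoutI φ ⧸ H := fun p => (wordVal φ gen (path p))⁻¹ • y₀
  have hloop : ∀ s, Γ.Reads v₀ s v₀ → (wordVal φ gen s) • y₀ = y₀ := by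
    intro s hs
    rw [hstab, ← SetLike.mem_coe, ← hH]
    exact ⟨s, hs, rfl⟩
  have hι : ∀ p s q, Γ.Reads p s q → ι q = (wordVal φ gen s)⁻¹ • ι p := by
    intro p s q h
    have := hloop _ (((hpath p).append h).append (hpath q).inv)
    rw [wordVal_append, wordVal_append, wordVal_invWord, mul_smul] at this
    have h2 := eq_inv_smul_iff.2 this
    simp only [ι]
    rw [h2, mul_inv_rev, mul_smul]
  have hι₀ : ι v₀ = y₀ := inv_smul_eq_iff.2 (hloop _ (hpath v₀)).symm
  let P : Fin 2 → Set (PushoutI φ ⧸ H) := fun i => ι '' {p | HasColour gen Γ i p}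
  have hP : Invariant φ P := by
    rintro i a _ ⟨p, hp, rfl⟩
    obtain ⟨s, hs, hv⟩ := exists_word_of_factor (φ := φ) hgen i a⁻¹
    obtain ⟨q, hq, hq'⟩ := (hΓ.colourComplete i).exists_reads hs hp
    refine ⟨q, hq', ?_⟩
    rw [hι p s q hq.of_colourPart, hv]
    simp [sylVal]
  have hread : ∀ p s q, Γ.Reads p s q →
      Readable (φ := φ) P (ι p) (s.map (letterSyl gen)) := by
    intro p s q h
    induction h with
    | nil => trivial
    | @cons p q r l s e _ ih =>
      refine ⟨⟨p, ⟨l, q, e, rfl⟩, rfl⟩, ?_⟩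
      rw [sylVal_letterSyl]
      rwa [hι p [l] q (.cons e (.nil _)), wordVal_cons, wordVal_nil, mul_one] at ih
  obtain ⟨z, h1, h2, h3⟩ := exists_pow_smul_eq hφ hP (Set.finite_range ι)
    (fun i => Set.image_subset_range _ _) (y := y₀) (fun h hh => by
      rw [hstab, ← SetLike.mem_coe, ← hH] at hh
      obtain ⟨s, hs, rfl⟩ := hh
      refine ⟨_, listVal_map_letterSyl s, ?_⟩
      have := hread _ _ _ hs
      rwa [hι₀] at this) hg hn ((hstab _).2 hgn)
  refine ⟨z, h1, h2.trans ?_, (hstab _).1 h3⟩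
  rw [← Set.image_univ, ← Set.ncard_univ V]
  exact Set.ncard_image_le

end Graphs

/-! ### The graph of an invariant family -/

section FamilyGraph

open LabelledGraph

universe u v w x y

variable {A : Type u} {G : Fin 2 → Type v} [Group A] [∀ i, Group (G i)]
  {φ : ∀ i, A →* G i} {X : Type x} {gen : X → Σ i, G i} {V : Type w}
  {Y : Type y} [MulAction (PushoutI φ) Y] {P : Fin 2 → Set Y}

variable (gen) in
/-- The graph of an invariant family `P`, with vertices parametrized by `ι : V → Y`: the letter
`l` of colour `i` leads from each point of `P i` to its translate by the inverse of `l`. -/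
def familyGraph (hP : Invariant φ P) (ι : V → Y) : LabelledGraph X V where
  edge p l q := ι p ∈ P (gen l.1).1 ∧ ι q = (letterVal φ gen l)⁻¹ • ι p
  edge_rev := by
    rintro p x b q ⟨h1, h2⟩
    refine ⟨?_, ?_⟩
    · rw [h2, ← sylVal_letterSyl]
      exact hP.inv (letterSyl gen (x, b)) h1
    · rw [h2, letterVal_flip, inv_inv, smul_inv_smul]

variable {hP : Invariant φ P} {ι : V → Y}

lemma familyGraph_reads {p q : V} {s : List (X × Bool)}
    (h : (familyGraph gen hP ι).Reads p s q) : ι q = (wordVal φ gen s)⁻¹ • ι p := by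
  induction h with
  | nil => simp
  | cons e _ ih => rw [ih, e.2, wordVal_cons, mul_inv_rev, mul_smul]

lemma mem_of_hasColour {i : Fin 2} {p : V} (h : HasColour gen (familyGraph gen hP ι) i p) :
    ι p ∈ P i := by
  obtain ⟨l, q, e, rfl⟩ := h
  exact e.1

lemma hasColour_of_mem (hV : ∀ i, P i ⊆ Set.range ι) {i : Fin 2} (hi : ∃ x, (gen x).1 = i)
    {p : V} (h : ι p ∈ P i) : HasColour gen (familyGraph gen hP ι) i p := by
  obtain ⟨x, rfl⟩ := hi
  obtain ⟨q, hq⟩ := hV _ (hP.inv (letterSyl gen (x, true)) h)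
  exact ⟨(x, true), q, ⟨h, by rw [hq, sylVal_letterSyl]⟩, rfl⟩

lemma exists_colourPart_reads (hV : ∀ i, P i ⊆ Set.range ι) {i : Fin 2} {s : List (X × Bool)}
    (hs : ∀ l ∈ s, (gen l.1).1 = i) {p : V} (h : ι p ∈ P i) :
    ∃ q, (colourPart gen (familyGraph gen hP ι) i).Reads p s q := by
  induction s generalizing p with
  | nil => exact ⟨p, .nil _⟩
  | cons l s ih =>
    have hl := hs l (by simp)
    have h' : ι p ∈ P (letterSyl gen l).1 := by rwa [letterSyl_fst, hl]
    have h2 := hP.inv _ h'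
    obtain ⟨q, hq⟩ := hV _ h2
    rw [← hq, letterSyl_fst, hl] at h2
    obtain ⟨r, hr⟩ := ih (fun l h => hs l (by simp [h])) h2
    exact ⟨r, .cons ⟨⟨h', by rw [hq, sylVal_letterSyl]⟩, hl⟩ hr⟩

/-- All elements of `G i` can be read at the points of `P i`, along edges of colour `i`. -/
lemma exists_colourPart_reads_factor
    (hgen : ∀ i, Subgroup.closure {a : G i | (⟨i, a⟩ : Σ i, G i) ∈ Set.range gen} = ⊤)
    (hV : ∀ i, P i ⊆ Set.range ι) {i : Fin 2} {p : V} (h : ι p ∈ P i) (a : G i) :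
    ∃ s q, (colourPart gen (familyGraph gen hP ι) i).Reads p s q ∧
      wordVal φ gen s = sylVal φ ⟨i, a⟩ ∧ ι q = (sylVal φ ⟨i, a⟩)⁻¹ • ι p := by
  obtain ⟨s, hs, hv⟩ := exists_word_of_factor (φ := φ) hgen i a
  obtain ⟨q, hq⟩ := exists_colourPart_reads (hP := hP) hV hs h
  exact ⟨s, q, hq, hv, by rw [familyGraph_reads hq.of_colourPart, hv]⟩

lemma exists_reads_of_readable
    (hgen : ∀ i, Subgroup.closure {a : G i | (⟨i, a⟩ : Σ i, G i) ∈ Set.range gen} = ⊤)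
    (hV : ∀ i, P i ⊆ Set.range ι) {L : List (Σ i, G i)} {p : V}
    (h : Readable (φ := φ) P (ι p) L) :
    ∃ s q, (familyGraph gen hP ι).Reads p s q ∧ wordVal φ gen s = listVal φ L := by
  induction L generalizing p with
  | nil => exact ⟨[], p, .nil _, rfl⟩
  | cons g L ih =>
    obtain ⟨s, q, h1, h2, h3⟩ := exists_colourPart_reads_factor (hP := hP) hgen hV h.1 g.2
    obtain ⟨t, r, h4, h5⟩ := ih (p := q) (by rw [h3]; exact h.2)
    exact ⟨s ++ t, r, h1.of_colourPart.append h4, by rw [wordVal_append, h2, h5, listVal_cons]⟩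

/-- The value of a word of one colour lies in the factor of that colour. -/
lemma exists_sylVal_of_reads {Γ : LabelledGraph X V} {i : Fin 2} {p q : V}
    {s : List (X × Bool)} (h : (colourPart gen Γ i).Reads p s q) :
    ∃ a : G i, wordVal φ gen s = sylVal φ ⟨i, a⟩ := by
  induction h with
  | nil => exact ⟨1, by simp [sylVal]⟩
  | @cons p q r l s e _ ih =>
    obtain ⟨a, ha⟩ := ih
    obtain rfl := e.2
    exact ⟨(show G (gen l.1).1 from (letterSyl gen l).2) * a, by
      rw [wordVal_cons, ha, sylVal_mul, ← sylVal_letterSyl]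
      rfl⟩

/-- A monochromatic component of the graph of a family is the relative Cayley graph of the
stabilizer of one of its vertices. -/
lemma familyGraph_component_isomorphic
    (hgen : ∀ i, Subgroup.closure {a : G i | (⟨i, a⟩ : Σ i, G i) ∈ Set.range gen} = ⊤)
    (hV : ∀ i, P i ⊆ Set.range ι) (hι : Function.Injective ι) {i : Fin 2} {p : V}
    (hp : ι p ∈ P i) :
    (component gen (familyGraph gen hP ι) i p).Isomorphic
      (relCayley gen i ((MulAction.stabilizer (PushoutI φ) (ι p)).comap (PushoutI.of i))) := by
  set S := (MulAction.stabilizer (PushoutI φ) (ι p)).comap (PushoutI.of (φ := φ) i) with hS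
  have hmk : ∀ a b : G i, (Quotient.mk (QuotientGroup.rightRel S) a = Quotient.mk _ b) ↔
      (sylVal φ ⟨i, a⟩)⁻¹ • ι p = (sylVal φ ⟨i, b⟩)⁻¹ • ι p := by
    intro a b
    rw [Quotient.eq, QuotientGroup.rightRel_apply, hS, Subgroup.mem_comap,
      MulAction.mem_stabilizer_iff, map_mul, map_inv, mul_smul, eq_inv_smul_iff]
    rfl
  have hex : ∀ q : compVerts gen (familyGraph gen hP ι) i p,
      ∃ a : G i, ι q = (sylVal φ ⟨i, a⟩)⁻¹ • ι p := by
    rintro ⟨q, s, hs⟩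
    obtain ⟨a, ha⟩ := exists_sylVal_of_reads (φ := φ) hs
    exact ⟨a, by rw [← ha, familyGraph_reads hs.of_colourPart]⟩
  choose f hf using hex
  have hbij : Function.Bijective fun q => (Quotient.mk (QuotientGroup.rightRel S) (f q)) := by
    constructor
    · intro q r h
      rw [hmk, ← hf, ← hf] at h
      exact Subtype.ext (hι h)
    · intro a
      obtain ⟨a, rfl⟩ := Quotient.exists_rep a
      obtain ⟨s, q, h1, h2, h3⟩ := exists_colourPart_reads_factor (hP := hP) hgen hV hp a
      refine ⟨⟨q, s, h1⟩, ?_⟩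
      rw [hmk, ← hf, h3]
  refine ⟨Equiv.ofBijective _ hbij, ?_⟩
  rintro q l r
  have hlet : ∀ a : G i, gen l.1 = ⟨i, a⟩ →
      letterVal φ gen l = sylVal φ ⟨i, if l.2 then a else a⁻¹⟩ := by
    intro a ha
    rw [← sylVal_letterSyl]
    simp only [letterSyl]
    rw [ha]
  simp only [Equiv.ofBijective_apply]
  constructor
  · rintro ⟨⟨-, h2⟩, h3⟩
    obtain ⟨a, ha⟩ : ∃ a : G i, gen l.1 = ⟨i, a⟩ := by
      subst h3
      exact ⟨(gen l.1).2, rfl⟩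
    refine ⟨a, ha, f q, rfl, ?_⟩
    rw [hmk, ← hf, sylVal_mul, mul_inv_rev, mul_smul, ← hf, h2, hlet a ha]
  · rintro ⟨a, ha, g, h1, h2⟩
    rw [hmk, ← hf] at h1 h2
    have hi : (gen l.1).1 = i := by rw [ha]
    refine ⟨⟨?_, ?_⟩, hi⟩
    · rw [hi, h1]
      exact hP.inv ⟨i, g⟩ hp
    · rw [h2, h1, sylVal_mul, mul_inv_rev, mul_smul, hlet a ha]

lemma familyGraph_isPrecover
    (hgen : ∀ i, Subgroup.closure {a : G i | (⟨i, a⟩ : Σ i, G i) ∈ Set.range gen} = ⊤)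
    (hV : ∀ i, P i ⊆ Set.range ι) (hι : Function.Injective ι) {v₀ : V}
    (hreach : ∀ p, ∃ L, Readable (φ := φ) P (ι v₀) L ∧ ι p = (listVal φ L)⁻¹ • ι v₀) :
    IsPrecover φ gen (familyGraph gen hP ι) := by
  have hpath : ∀ p, ∃ s, (familyGraph gen hP ι).Reads v₀ s p := by
    intro p
    obtain ⟨L, h1, h2⟩ := hreach p
    obtain ⟨s, q, h3, h4⟩ := exists_reads_of_readable (hP := hP) hgen hV h1
    obtain rfl : q = p := hι (by rw [h2, familyGraph_reads h3, h4])
    exact ⟨s, h3⟩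
  refine ⟨⟨⟨v₀⟩, fun p q => ?_⟩, fun p s q h h1 => ?_, fun i p hp => ?_⟩
  · obtain ⟨s, hs⟩ := hpath p
    obtain ⟨t, ht⟩ := hpath q
    exact ⟨_, hs.inv.append ht⟩
  · apply hι
    rw [familyGraph_reads h, h1]
    simp
  · exact ⟨_, familyGraph_component_isomorphic hgen hV hι (mem_of_hasColour hp)⟩

/-! ### Minimal families -/

/-- Families which support the stabilizer of `y₀`: they are finite, invariant, reachable from
`y₀`, all elements of the stabilizer are readable at `y₀`, and `y₀` has both colours if some
nontrivial element of the amalgamated subgroup fixes it. -/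
structure Supports (φ : ∀ i, A →* G i) {Y : Type y} [MulAction (PushoutI φ) Y]
    (P : Fin 2 → Set Y) (y₀ : Y) : Prop where
  invariant : Invariant φ P
  finite : ∀ i, (P i).Finite
  reach : ∀ i, ∀ y ∈ P i, ∃ L, Readable (φ := φ) P y₀ L ∧ y = (listVal φ L)⁻¹ • y₀
  read : ∀ h : PushoutI φ, h • y₀ = y₀ → ∃ L, listVal φ L = h ∧ Readable (φ := φ) P y₀ L
  base : (∃ a : A, PushoutI.base φ a ≠ 1 ∧ PushoutI.base φ a • y₀ = y₀) → ∀ i, y₀ ∈ P i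

/-- Removal of a redundant component: let `C ⊆ P i` be the component of `t` (the orbit of `t`
under `G i`), such that the stabilizer of `t` in `G i` is contained in the amalgamated subgroup
`A`, and the points of `C` which also have the other colour `j` form an orbit of `A`. Then a path
through `C` from one such point to another has its label in `A`, and can be replaced by a step of
colour `j`. -/
lemma Supports.remove {y₀ : Y} (hP : Supports φ P y₀) {i j : Fin 2} (hji : j ≠ i)
    (hj : ∀ k, k = i ∨ k = j) {t : Y}
    (hK : ∀ a : G i, sylVal φ ⟨i, a⟩ • t = t → a ∈ (φ i).range)
    (hVB : ∀ a : G i, sylVal φ ⟨i, a⟩ • t ∈ P j →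
      ∃ b : A, sylVal φ ⟨i, a⟩ • t = PushoutI.base φ b • t)
    (hv : ∀ a : G i, y₀ = sylVal φ ⟨i, a⟩ • t → y₀ ∈ P j ∧
      ∀ a : G i, sylVal φ ⟨i, a⟩ • t = t → a = 1) :
    Supports φ (fun k => {y ∈ P k | k = i → ∀ a : G i, y ≠ sylVal φ ⟨i, a⟩ • t}) y₀ := by
  set Q : Fin 2 → Set Y := fun k => {y ∈ P k | k = i → ∀ a : G i, y ≠ sylVal φ ⟨i, a⟩ • t} with hQ
  have hQj : ∀ y, y ∈ P j → y ∈ Q j := fun y hy => ⟨hy, fun h => absurd h hji⟩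
  have hinv : Invariant φ Q := by
    rintro k g y ⟨h1, h2⟩
    refine ⟨hP.invariant k g y h1, ?_⟩
    rintro rfl a ha
    refine h2 rfl (g⁻¹ * a) ?_
    rw [sylVal_mul, mul_smul, ← ha]
    simp [sylVal]
  -- Paths which start and end outside `C`, or at points of colour `j`, avoid `C` after rerouting.
  have key : ∀ (n : ℕ) (L : List (Σ i, G i)), L.length ≤ n → ∀ y,
      (∀ a : G i, y = sylVal φ ⟨i, a⟩ • t → y ∈ P j) → Readable (φ := φ) P y L →
      (∀ a : G i, (listVal φ L)⁻¹ • y = sylVal φ ⟨i, a⟩ • t → (listVal φ L)⁻¹ • y ∈ P j) →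
      ∃ M, listVal φ M = listVal φ L ∧ Readable (φ := φ) Q y M := by
    intro n
    induction n with
    | zero =>
      intro L hL y _ _ _
      obtain rfl : L = [] := List.length_eq_zero_iff.1 (by omega)
      exact ⟨[], rfl, trivial⟩
    | succ n ih =>
      intro L hL y hy hr hend
      match L, hL, hr, hend with
      | [], _, _, _ => exact ⟨[], rfl, trivial⟩
      | ⟨k, g⟩ :: L, hL, hr, hend =>
        have hL' : L.length ≤ n := by simpa using hL
        have hend' : ∀ a : G i,
            (listVal φ L)⁻¹ • (sylVal φ ⟨k, g⟩)⁻¹ • y = sylVal φ ⟨i, a⟩ • t →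
            (listVal φ L)⁻¹ • (sylVal φ ⟨k, g⟩)⁻¹ • y ∈ P j := by
          simpa only [listVal_cons, mul_inv_rev, mul_smul] using hend
        by_cases hkC : y ∈ Q k
        · obtain ⟨M, h1, h2⟩ := ih L hL' _ (fun a ha => by
            rcases hj k with rfl | rfl
            · exact absurd ha ((hinv.inv ⟨k, g⟩ hkC).2 rfl a)
            · exact (hinv.inv ⟨k, g⟩ hkC).1) hr.2 hend'
          exact ⟨⟨k, g⟩ :: M, by rw [listVal_cons, listVal_cons, h1], hkC, h2⟩
        · obtain ⟨rfl, a, ha⟩ : k = i ∧ ∃ a : G i, y = sylVal φ ⟨i, a⟩ • t := by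
            by_contra hcon
            exact hkC ⟨hr.1, fun h a h' => hcon ⟨h, a, h'⟩⟩
          have hy1 : (sylVal φ ⟨k, g⟩)⁻¹ • y = sylVal φ ⟨k, g⁻¹ * a⟩ • t := by
            rw [ha, sylVal_mul, mul_smul]
            simp [sylVal]
          by_cases hj1 : (sylVal φ ⟨k, g⟩)⁻¹ • y ∈ P j
          · obtain ⟨M, h1, h2⟩ := ih L hL' _ (fun _ _ => hj1) hr.2 hend'
            -- The step by `g` leads from `a₁ • t` to `a₂ • t`, hence `g` lies in `A`.
            obtain ⟨a₁, ha₁⟩ := hVB a (ha ▸ hy a ha)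
            obtain ⟨a₂, ha₂⟩ := hVB (g⁻¹ * a) (hy1 ▸ hj1)
            obtain ⟨b, hb⟩ := hK (φ k a₁⁻¹ * g * φ k a₂) (by
              rw [sylVal_mul, sylVal_mul, sylVal_base, sylVal_base, mul_smul, ← ha₂, ← hy1,
                mul_smul, smul_inv_smul, ha, ha₁, map_inv, inv_smul_smul])
            have hg : sylVal φ ⟨k, g⟩ = sylVal φ ⟨j, φ j (a₁ * b * a₂⁻¹)⟩ := by
              rw [sylVal_base, ← sylVal_base k, map_mul, map_mul, hb]
              simp [mul_assoc]
            refine ⟨⟨j, φ j (a₁ * b * a₂⁻¹)⟩ :: M, by rw [listVal_cons, listVal_cons, h1, hg],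
              hQj _ (hy a ha), ?_⟩
            rwa [← hg]
          · match L, hL', hr, hend' with
            | [], _, _, hend' =>
              rw [listVal_nil, inv_one, one_smul] at hend'
              exact absurd (hend' _ hy1) hj1
            | ⟨m, g'⟩ :: L, hL', hr, hend' =>
              obtain rfl : m = k := by
                rcases hj m with h | h
                · exact h
                · subst h
                  exact absurd hr.2.1 hj1
              have hgg := sylVal_mul (φ := φ) m g g'
              obtain ⟨M, h1, h2⟩ := ih (⟨m, g * g'⟩ :: L) (by simpa using hL') y hy
                ⟨hr.1, by rw [hgg, mul_inv_rev, mul_smul]; exact hr.2.2⟩ (by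
                  simpa only [listVal_cons, hgg, mul_inv_rev, mul_smul] using hend')
              exact ⟨M, by rw [h1, listVal_cons, listVal_cons, listVal_cons, hgg, mul_assoc], h2⟩
  have hy₀ : ∀ a : G i, y₀ = sylVal φ ⟨i, a⟩ • t → y₀ ∈ P j := fun a ha => (hv a ha).1
  refine ⟨hinv, fun k => (hP.finite k).subset fun y hy => hy.1, ?_, ?_, ?_⟩
  · intro k y hyk
    obtain ⟨L, h1, h2⟩ := hP.reach k y hyk.1
    obtain ⟨M, h3, h4⟩ := key _ L le_rfl y₀ hy₀ h1 (fun a ha => by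
      rw [← h2] at ha ⊢
      rcases hj k with rfl | rfl
      · exact absurd ha (hyk.2 rfl a)
      · exact hyk.1)
    exact ⟨M, h4, by rw [h3, h2]⟩
  · intro h hh
    obtain ⟨L, h1, h2⟩ := hP.read h hh
    have : (listVal φ L)⁻¹ • y₀ = y₀ := by
      rw [h1]
      exact inv_smul_eq_iff.2 hh.symm
    obtain ⟨M, h3, h4⟩ := key _ L le_rfl y₀ hy₀ h2 (by rwa [this])
    exact ⟨M, by rw [h3, h1], h4⟩
  · rintro ⟨b, hb1, hb2⟩ k
    refine ⟨hP.base ⟨b, hb1, hb2⟩ k, ?_⟩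
    rintro rfl a ha
    refine hb1 ?_
    have h1 := (hv a ha).2 (a⁻¹ * φ k b * a) (by
      rw [sylVal_mul, sylVal_mul, mul_smul, mul_smul, ← ha, sylVal_base, hb2, ha, ← mul_smul,
        ← sylVal_mul]
      simp [sylVal])
    have h2 : φ k b = 1 := by
      rw [mul_assoc, inv_mul_eq_one] at h1
      exact (right_eq_mul.1 h1)
    rw [← sylVal_base k, h2]
    simp [sylVal]

/-- The graph of a supporting family with the least number of points is reduced. -/
theorem Supports.isReducedPrecover (hφ : ∀ i, Function.Injective (φ i))
    (hgen : ∀ i, Subgroup.closure {a : G i | (⟨i, a⟩ : Σ i, G i) ∈ Set.range gen} = ⊤)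
    {v₀ : V} (hS : Supports φ P (ι v₀))
    (hmin : ∀ Q : Fin 2 → Set Y, Supports φ Q (ι v₀) →
      ∑ k, (P k).ncard ≤ ∑ k, (Q k).ncard)
    (hV : ∀ i, P i ⊆ Set.range ι) (hι : Function.Injective ι)
    (hι' : ∀ p, p = v₀ ∨ ∃ i, ι p ∈ P i) :
    IsReducedPrecover φ gen (familyGraph gen hS.invariant ι) v₀ := by
  have hof : ∀ {i : Fin 2} {a b : G i}, sylVal φ ⟨i, a⟩ = sylVal φ ⟨i, b⟩ → a = b :=
    fun h => PushoutI.of_injective hφ _ h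
  have hlt : ∀ Q : Fin 2 → Set Y, Supports φ Q (ι v₀) → (∀ k, Q k ⊆ P k) →
      ∀ i y, y ∈ P i → y ∈ Q i := by
    intro Q hQ hQP i y hy
    by_contra hyQ
    refine absurd (hmin Q hQ) (not_le.2 (Finset.sum_lt_sum
      (fun k _ => Set.ncard_le_ncard (hQP k) (hS.finite k)) ⟨i, Finset.mem_univ _, ?_⟩))
    exact Set.ncard_lt_ncard ⟨hQP i, fun h => hyQ (h hy)⟩ (hS.finite i)
  refine ⟨familyGraph_isPrecover hgen hV hι (v₀ := v₀) fun p => ?_, fun i p hp hred => ?_,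
    fun i hi hne => ?_⟩
  · rcases hι' p with rfl | ⟨i, hi⟩
    · exact ⟨[], trivial, by simp⟩
    · exact hS.reach i _ hi
  · have hpi := mem_of_hasColour hp
    rcases hred with ⟨huniq, hlab⟩ | ⟨-, t, ht, hbi, hK, hVB, hv⟩
    · -- All paths at `v₀` lie in the only component, so the stabilizer is trivial and the empty
      -- family supports it.
      have htriv : ∀ h : PushoutI φ, h • ι v₀ = ι v₀ → h = 1 := by
        intro h hh
        obtain ⟨L, h1, h2⟩ := hS.read h hh
        obtain ⟨s, q, h3, h4⟩ := exists_reads_of_readable (hP := hS.invariant) hgen hV h2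
        obtain rfl : q = v₀ := hι (by
          rw [familyGraph_reads h3, h4, h1]
          exact inv_smul_eq_iff.2 hh.symm)
        have hcol : ∀ {a b : V} {s}, (familyGraph gen hS.invariant ι).Reads a s b →
            (colourPart gen (familyGraph gen hS.invariant ι) i).Reads a s b := by
          intro a b s hs
          induction hs with
          | nil => exact .nil _
          | @cons a b r l s e _ ih => exact .cons ⟨e, (huniq _ a ⟨l, b, e, rfl⟩).1⟩ ih
        match s, h3, h4 with
        | [], _, h4 => rw [← h1, ← h4, wordVal_nil]
        | l :: s, h3, h4 =>
          obtain ⟨r, hr⟩ : q ∈ compVerts gen (familyGraph gen hS.invariant ι) i p := by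
            cases h3 with
            | @cons _ r _ _ _ e _ => exact (huniq _ q ⟨l, r, e, rfl⟩).2
          have : wordVal φ gen (r ++ (l :: s) ++ invWord r) ∈
              Lab φ gen (colourPart gen (familyGraph gen hS.invariant ι) i) p :=
            ⟨_, (hr.append (hcol h3)).append hr.inv, rfl⟩
          rw [hlab, Set.mem_singleton_iff, wordVal_append, wordVal_append, wordVal_invWord,
            conj_eq_one_iff, h4, h1] at this
          exact this
      have hempty : Supports φ (fun _ => (∅ : Set Y)) (ι v₀) := by
        refine ⟨fun _ _ _ h => h, fun _ => Set.finite_empty, fun _ _ h => absurd h (by simp),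
          fun h hh => ⟨[], by rw [htriv h hh]; rfl, trivial⟩, ?_⟩
        rintro ⟨a, h1, h2⟩
        exact absurd (htriv _ h2) h1
      exact hlt _ hempty (fun _ => Set.empty_subset _) i _ hpi
    · obtain ⟨j, hji, hj⟩ : ∃ j, j ≠ i ∧ ∀ k, k = i ∨ k = j := by
        have : ∀ i : Fin 2, ∃ j, j ≠ i ∧ ∀ k, k = i ∨ k = j := by decide
        exact this i
      have hsym : ∀ k, ∃ x, (gen x).1 = k := fun k => by
        obtain ⟨l, _, e⟩ := hbi k
        exact ⟨l.1, e.2⟩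
      have hti : ι t ∈ P i := mem_of_hasColour (hbi i)
      obtain ⟨r, hr⟩ := ht
      have hlabt : ∀ a : G i, sylVal φ ⟨i, a⟩ • ι t = ι t →
          sylVal φ ⟨i, a⟩ ∈
            Lab φ gen (colourPart gen (familyGraph gen hS.invariant ι) i) t := by
        intro a ha
        obtain ⟨s, q, h1, h2, h3⟩ :=
          exists_colourPart_reads_factor (hP := hS.invariant) hgen hV hti a
        obtain rfl : q = t := hι (by rw [h3]; exact inv_smul_eq_iff.2 ha.symm)
        exact ⟨s, h1, h2⟩
      have hread : ∀ a : G i, ∃ s q,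
          (colourPart gen (familyGraph gen hS.invariant ι) i).Reads t s q ∧
          ι q = sylVal φ ⟨i, a⟩ • ι t := by
        intro a
        obtain ⟨s, q, h1, -, h3⟩ :=
          exists_colourPart_reads_factor (hP := hS.invariant) hgen hV hti a⁻¹
        exact ⟨s, q, h1, by simpa [sylVal] using h3⟩
      have hrem := hS.remove hji hj (t := ι t) (fun a ha => ?_) (fun a ha => ?_) (fun a ha => ?_)
      · exact (hlt _ hrem (fun k y hy => hy.1) i _ hti).2 rfl 1 (by simp [sylVal])
      · obtain ⟨b, hb⟩ := hK (hlabt a ha)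
        rw [← sylVal_base i] at hb
        exact ⟨b, hof hb⟩
      · obtain ⟨s, q, h1, h2⟩ := hread a
        have hq : q ∈ orbitA φ gen (familyGraph gen hS.invariant ι) i t := by
          rw [← hVB]
          refine ⟨⟨_, hr.append h1⟩, fun k => hasColour_of_mem hV (hsym k) ?_⟩
          rw [h2]
          rcases hj k with rfl | rfl
          · exact hS.invariant k a _ hti
          · exact ha
        obtain ⟨s', h3, b, hb⟩ := hq
        refine ⟨b⁻¹, ?_⟩
        rw [← h2, familyGraph_reads h3.of_colourPart, ← hb, map_inv]
      · obtain ⟨s, q, h1, h2⟩ := hread a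
        obtain rfl : q = v₀ := hι (by rw [h2, ha])
        obtain ⟨h3, h4⟩ := hv ⟨_, hr.append h1⟩
        refine ⟨mem_of_hasColour (h3 j), fun b hb => ?_⟩
        have := hlabt b hb
        rw [h4, Set.mem_singleton_iff] at this
        exact hof (by rw [this]; simp [sylVal])
  · obtain ⟨g, ⟨⟨s, hs, hsg⟩, a, ha⟩, hg⟩ : ∃ g ∈ Lab φ gen
        (colourPart gen (familyGraph gen hS.invariant ι) i) v₀ ∩
          ((PushoutI.base φ).range : Set (PushoutI φ)), g ≠ 1 := by
      by_contra! hcon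
      refine hne (Set.eq_singleton_iff_unique_mem.2 ⟨⟨⟨[], .nil _, rfl⟩, one_mem _⟩, hcon⟩)
    have ha1 : a ≠ 1 := by
      rintro rfl
      exact hg (by rw [← ha, map_one])
    have hfix : PushoutI.base φ a • ι v₀ = ι v₀ := by
      have := familyGraph_reads hs.of_colourPart
      rw [hsg, ← ha] at this
      exact (eq_inv_smul_iff.1 this)
    intro k
    refine hasColour_of_mem hV ?_ (hS.base ⟨a, ha ▸ hg, hfix⟩ k)
    by_contra! hcon
    have hbot := hgen k
    have : {b : G k | (⟨k, b⟩ : Σ i, G i) ∈ Set.range gen} = ∅ := by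
      ext b
      simp only [Set.mem_ofPred_eq, Set.mem_range, Set.mem_empty_iff_false, iff_false, not_exists]
      intro x hx
      exact hcon x (by rw [hx])
    rw [this, Subgroup.closure_empty] at hbot
    have h1 : φ k a ∈ (⊥ : Subgroup (G k)) := by rw [hbot]; trivial
    exact ha1 (hφ k (by rw [Subgroup.mem_bot.1 h1, map_one]))

/-- The labels of the closed paths at `v₀` in the graph of a supporting family are the elements
of the stabilizer. -/
lemma Supports.lab_eq
    (hgen : ∀ i, Subgroup.closure {a : G i | (⟨i, a⟩ : Σ i, G i) ∈ Set.range gen} = ⊤)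
    {v₀ : V} (hS : Supports φ P (ι v₀)) (hV : ∀ i, P i ⊆ Set.range ι)
    (hι : Function.Injective ι) :
    Lab φ gen (familyGraph gen hS.invariant ι) v₀ = {h | h • ι v₀ = ι v₀} := by
  ext h
  constructor
  · rintro ⟨s, hs, rfl⟩
    exact eq_inv_smul_iff.1 (familyGraph_reads hs)
  · intro hh
    obtain ⟨L, h1, h2⟩ := hS.read h hh
    obtain ⟨s, q, h3, h4⟩ := exists_reads_of_readable (hP := hS.invariant) hgen hV h2
    obtain rfl : q = v₀ := hι (by
      rw [familyGraph_reads h3, h4, h1]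
      exact inv_smul_eq_iff.2 hh.symm)
    exact ⟨s, h3, by rw [h4, h1]⟩

end FamilyGraph

/-! ### The family of the prefixes of finitely many words -/

section PrefixFamily

universe u v w x y

variable {A : Type u} {G : Fin 2 → Type v} [Group A] [∀ i, Group (G i)]
  {φ : ∀ i, A →* G i} {X : Type x} {gen : X → Σ i, G i}
  {Y : Type y} [MulAction (PushoutI φ) Y]

lemma Readable.invList {P : Fin 2 → Set Y} (hP : Invariant φ P) {L : List (Σ i, G i)} {y : Y}
    (h : Readable (φ := φ) P y L) :
    Readable (φ := φ) P ((listVal φ L)⁻¹ • y) (invList L) := by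
  induction L generalizing y with
  | nil => trivial
  | cons g L ih =>
    have e : AmalgamGraph.invList (g :: L) = AmalgamGraph.invList L ++ [⟨g.1, g.2⁻¹⟩] := by
      simp [AmalgamGraph.invList]
    rw [e, readable_append, listVal_cons, mul_inv_rev, mul_smul]
    refine ⟨ih h.2, ?_, trivial⟩
    rw [listVal_invList, inv_inv, smul_inv_smul]
    exact hP.inv g h.1

/-- Readability at a fixed point passes from generators to the subgroup they generate. -/
lemma exists_readable_of_mem_closure {P : Fin 2 → Set Y} (hP : Invariant φ P) {y : Y}
    {S : Set (PushoutI φ)}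
    (hS : ∀ h ∈ S, h • y = y ∧ ∃ L, listVal φ L = h ∧ Readable (φ := φ) P y L)
    {h : PushoutI φ} (hh : h ∈ Subgroup.closure S) :
    h • y = y ∧ ∃ L, listVal φ L = h ∧ Readable (φ := φ) P y L := by
  induction hh using Subgroup.closure_induction with
  | mem h hh => exact hS h hh
  | one => exact ⟨one_smul _ _, [], rfl, trivial⟩
  | mul a b _ _ ha hb =>
    obtain ⟨ha, L, rfl, hL⟩ := ha
    obtain ⟨hb, M, rfl, hM⟩ := hb
    refine ⟨by rw [mul_smul, hb, ha], L ++ M, by simp, readable_append.2 ⟨hL, ?_⟩⟩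
    rwa [inv_smul_eq_iff.2 ha.symm]
  | inv a _ ha =>
    obtain ⟨ha, L, rfl, hL⟩ := ha
    have ha' := inv_smul_eq_iff.2 ha.symm
    refine ⟨ha', AmalgamGraph.invList L, listVal_invList L, ?_⟩
    have := hL.invList hP
    rwa [ha'] at this

variable (φ gen) in
/-- The family of the components of both colours through all points reached from `y₀` by reading
prefixes of the words `hs`. -/
def prefixFamily (y₀ : Y) (hs : List (List (X × Bool))) (i : Fin 2) : Set Y :=
  {y | ∃ (a : G i) (s : List (X × Bool)), (s = [] ∨ ∃ h ∈ hs, s <+: h) ∧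
    y = sylVal φ ⟨i, a⟩ • (wordVal φ gen s)⁻¹ • y₀}

lemma prefixFamily_invariant (y₀ : Y) (hs : List (List (X × Bool))) :
    Invariant φ (prefixFamily φ gen y₀ hs) := by
  rintro i g _ ⟨a, s, h1, rfl⟩
  exact ⟨g * a, s, h1, by rw [sylVal_mul, mul_smul]⟩

lemma mem_prefixFamily (y₀ : Y) {hs : List (List (X × Bool))} {s : List (X × Bool)}
    (h : s = [] ∨ ∃ h ∈ hs, s <+: h) (i : Fin 2) :
    (wordVal φ gen s)⁻¹ • y₀ ∈ prefixFamily φ gen y₀ hs i :=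
  ⟨1, s, h, by simp [sylVal]⟩

lemma prefixFamily_readable (y₀ : Y) {hs : List (List (X × Bool))} {s : List (X × Bool)}
    (h : ∃ h ∈ hs, s <+: h) :
    Readable (φ := φ) (prefixFamily φ gen y₀ hs) y₀ (s.map (letterSyl gen)) := by
  suffices H : ∀ t r, (∃ h ∈ hs, r ++ t <+: h) →
      Readable (φ := φ) (prefixFamily φ gen y₀ hs) ((wordVal φ gen r)⁻¹ • y₀)
        (t.map (letterSyl gen)) by
    simpa using H s [] (by simpa using h)
  intro t
  induction t with
  | nil => intro r _; trivial
  | cons l t ih =>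
    rintro r ⟨h, h1, h2⟩
    refine ⟨mem_prefixFamily y₀ (Or.inr ⟨h, h1, (List.prefix_append _ _).trans h2⟩) _, ?_⟩
    have := ih (r ++ [l]) ⟨h, h1, by simpa using h2⟩
    rwa [wordVal_append, wordVal_cons, wordVal_nil, mul_one, mul_inv_rev, mul_smul,
      ← sylVal_letterSyl] at this

/-- A bound for the number of points of the family of prefixes, in terms of the words. -/
noncomputable def prefixBound (G : Fin 2 → Type v) (hs : List (List (X × Bool))) : ℕ :=
  Nat.card (Σ i, G i) * (hs.length * (hs.flatten.length + 1) + 1)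

lemma exists_prefixFamily_subset [∀ i, Finite (G i)] (y₀ : Y) (hs : List (List (X × Bool))) :
    ∃ Z : Set Y, Z.Finite ∧ Z.ncard ≤ prefixBound G hs ∧
      ∀ i, prefixFamily φ gen y₀ hs i ⊆ Z := by
  let F : (Σ i, G i) × Option (Fin hs.length × Fin (hs.flatten.length + 1)) → Y := fun z =>
    sylVal φ z.1 • (wordVal φ gen (z.2.elim [] fun k => hs[k.1].take k.2))⁻¹ • y₀
  refine ⟨Set.range F, Set.finite_range F, ?_, ?_⟩
  · rw [← Set.image_univ]
    refine (Set.ncard_image_le Set.finite_univ).trans ?_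
    rw [Set.ncard_univ, Nat.card_prod, prefixBound]
    simp
  · rintro i _ ⟨a, s, h, rfl⟩
    rcases h with rfl | ⟨h, hh, hs'⟩
    · exact ⟨(⟨i, a⟩, none), by simp [F]⟩
    · obtain ⟨k, hk, rfl⟩ := List.getElem_of_mem hh
      have hlen : s.length < hs.flatten.length + 1 :=
        Nat.lt_succ_of_le (hs'.length_le.trans (List.sublist_flatten_of_mem hh).length_le)
      refine ⟨(⟨i, a⟩, some (⟨k, hk⟩, ⟨s.length, hlen⟩)), ?_⟩
      have := List.prefix_iff_eq_take.1 hs'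
      simp only [F, Option.elim, Fin.getElem_fin]
      rw [← this]

lemma prefixFamily_supports [∀ i, Finite (G i)] {y₀ : Y} {hs : List (List (X × Bool))}
    (hy₀ : ∀ h, h • y₀ = y₀ ↔ h ∈ genSubgroup φ gen hs) :
    Supports φ (prefixFamily φ gen y₀ hs) y₀ := by
  have hinv := prefixFamily_invariant (φ := φ) (gen := gen) y₀ hs
  obtain ⟨Z, hZ, -, hsub⟩ := exists_prefixFamily_subset (φ := φ) (gen := gen) y₀ hs
  refine ⟨hinv, fun i => hZ.subset (hsub i), ?_, fun h hh => ?_, fun _ i => ?_⟩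
  · rintro i _ ⟨a, s, h, rfl⟩
    refine ⟨s.map (letterSyl gen) ++ [⟨i, a⁻¹⟩], readable_append.2 ⟨?_, ?_, trivial⟩, ?_⟩
    · rcases h with rfl | h
      · trivial
      · exact prefixFamily_readable y₀ h
    · rw [listVal_map_letterSyl]
      exact mem_prefixFamily y₀ h i
    · rw [listVal_append, listVal_map_letterSyl, mul_inv_rev, mul_smul]
      simp [sylVal]
  · refine (exists_readable_of_mem_closure hinv ?_ ((hy₀ h).1 hh)).2
    rintro _ ⟨s, hs', rfl⟩
    exact ⟨(hy₀ _).2 (Subgroup.subset_closure ⟨s, hs', rfl⟩), _, listVal_map_letterSyl s,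
      prefixFamily_readable y₀ ⟨s, hs', List.prefix_rfl⟩⟩
  · simpa using mem_prefixFamily (φ := φ) (gen := gen) (hs := hs) y₀ (Or.inl rfl) i

/-- Finitely generated subgroups have subgroup graphs. -/
theorem exists_isSubgroupGraph [∀ i, Finite (G i)] (hφ : ∀ i, Function.Injective (φ i))
    (hgen : ∀ i, Subgroup.closure {a : G i | (⟨i, a⟩ : Σ i, G i) ∈ Set.range gen} = ⊤)
    {H : Subgroup (PushoutI φ)} (hH : H.FG) :
    ∃ (V : Type) (Γ : LabelledGraph X V) (v₀ : V), IsSubgroupGraph φ gen H Γ v₀ := by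
  classical
  obtain ⟨hs, rfl⟩ : ∃ hs, H = genSubgroup φ gen hs := by
    obtain ⟨S, rfl⟩ := hH
    choose word hword using exists_word (φ := φ) hgen
    refine ⟨S.toList.map word, congrArg _ ?_⟩
    ext g
    simp [hword]
  let y₀ : PushoutI φ ⧸ genSubgroup φ gen hs := (1 : PushoutI φ)
  have hy₀ : ∀ h : PushoutI φ, h • y₀ = y₀ ↔ h ∈ genSubgroup φ gen hs :=
    smul_one_coset_eq_iff _
  have hex : ∃ n, ∃ P : Fin 2 → Set (PushoutI φ ⧸ genSubgroup φ gen hs),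
      ∑ k, (P k).ncard = n ∧ Supports φ P y₀ :=
    ⟨_, _, rfl, prefixFamily_supports hy₀⟩
  obtain ⟨P, hn, hP⟩ := Nat.find_spec hex
  have hmin : ∀ Q : Fin 2 → Set _, Supports φ Q y₀ → ∑ k, (P k).ncard ≤ ∑ k, (Q k).ncard :=
    fun Q hQ => hn ▸ Nat.find_min' hex ⟨Q, rfl, hQ⟩
  have hfin : Finite ↥(insert y₀ (⋃ i, P i)) :=
    ((Set.finite_iUnion hP.finite).insert y₀).to_subtype
  obtain ⟨n, ⟨e⟩⟩ := Finite.exists_equiv_fin ↥(insert y₀ (⋃ i, P i))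
  let ι : Fin n → PushoutI φ ⧸ genSubgroup φ gen hs := fun k => (e.symm k).1
  have hι : Function.Injective ι := fun a b h => e.symm.injective (Subtype.ext h)
  obtain ⟨v₀, hv₀⟩ : ∃ v₀, ι v₀ = y₀ := ⟨e ⟨y₀, Set.mem_insert _ _⟩, by simp [ι]⟩
  have hV : ∀ i, P i ⊆ Set.range ι := fun i y hy =>
    ⟨e ⟨y, Set.mem_insert_of_mem _ (Set.mem_iUnion.2 ⟨i, hy⟩)⟩, by simp [ι]⟩
  rw [← hv₀] at hP hmin hy₀
  refine ⟨Fin n, familyGraph gen hP.invariant ι, v₀, inferInstance,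
    hP.isReducedPrecover hφ hgen hmin hV hι fun p => ?_, ?_⟩
  · rcases (e.symm p).2 with h | h
    · exact Or.inl (hι (h.trans hv₀.symm))
    · exact Or.inr (Set.mem_iUnion.1 h)
  · rw [hP.lab_eq hgen hV hι]
    ext h
    exact hy₀ h

end PrefixFamily

/-! ### Extending a finite family to finite actions of both factors -/

section Extension

universe u v w x y

lemma exists_equivariant_map {A K : Type*} [Group A] [Group K] {f : A →* K}
    (hf : Function.Injective f) : ∃ α : K → A, ∀ p a, α (p * f a) = α p * a := by
  have h : ∀ p : K, ∃ a : A, f a = (Quotient.out (p : K ⧸ f.range))⁻¹ * p := fun p => by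
    rw [← MonoidHom.mem_range, ← QuotientGroup.eq]
    exact Quotient.out_eq _
  choose α hα using h
  refine ⟨α, fun p a => hf ?_⟩
  have e : ((p * f a : K) : K ⧸ f.range) = p := by
    rw [eq_comm, QuotientGroup.eq]
    simp
  rw [map_mul, hα, hα, e, mul_assoc]

variable {A : Type u} {G : Fin 2 → Type v} [Group A] [∀ i, Group (G i)]
  {φ : ∀ i, A →* G i} {Y : Type y} [MulAction (PushoutI φ) Y]

/-- Right actions of both factors on a type which agree on the amalgamated subgroup. -/
structure CompatibleActions (φ : ∀ i, A →* G i) {F : Type*} (R : (Σ i, G i) → F → F) :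
    Prop where
  map_mul : ∀ i (a b : G i) f, R ⟨i, a * b⟩ f = R ⟨i, b⟩ (R ⟨i, a⟩ f)
  map_one : ∀ i f, R ⟨i, 1⟩ f = f
  map_base : ∀ a f, R ⟨0, φ 0 a⟩ f = R ⟨1, φ 1 a⟩ f

/-- Both factors act on the product of the factors such that the actions agree on the amalgamated
subgroup `A` and there is an `A`-equivariant map to `A`. The first factor acts by multiplication
on the first coordinate, and the action of the second factor is conjugated by an involution which
exchanges the two actions of `A` by multiplication on one coordinate. -/
lemma exists_compatibleActions (hφ : ∀ i, Function.Injective (φ i)) :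
    ∃ (R : (Σ i, G i) → G 0 × G 1 → G 0 × G 1) (r : G 0 × G 1 → A), CompatibleActions φ R ∧
      ∀ i a f, r (R ⟨i, φ i a⟩ f) = r f * a := by
  obtain ⟨α, hα⟩ := exists_equivariant_map (hφ 0)
  obtain ⟨β, hβ⟩ := exists_equivariant_map (hφ 1)
  let ψ : G 0 × G 1 → G 0 × G 1 := fun f =>
    (f.1 * φ 0 ((α f.1)⁻¹ * β f.2), f.2 * φ 1 ((β f.2)⁻¹ * α f.1))
  have hψ : ∀ f, ψ (ψ f) = f := by
    rintro ⟨p, q⟩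
    simp only [ψ, hα, hβ]
    ext <;> simp [mul_assoc]
  let R' : ∀ i : Fin 2, G i → G 0 × G 1 → G 0 × G 1 := fun i =>
    match i with
    | 0 => fun a f => (f.1 * a, f.2)
    | 1 => fun b f => ψ ((ψ f).1, (ψ f).2 * b)
  have hR1 : ∀ (b : G 1) f, R' 1 b f = ψ ((ψ f).1, (ψ f).2 * b) := fun _ _ => rfl
  have hR0 : ∀ (a : G 0) f, R' 0 a f = (f.1 * a, f.2) := fun _ _ => rfl
  have hbase : ∀ a f, R' 0 (φ 0 a) f = R' 1 (φ 1 a) f := by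
    rintro a ⟨p, q⟩
    rw [hR0, hR1]
    simp only [ψ, hα, hβ]
    ext <;> simp [mul_assoc]
  have hr : ∀ a f, α (R' 0 (φ 0 a) f).1 = α f.1 * a := fun a f => hα _ _
  refine ⟨fun s => R' s.1 s.2, fun f => α f.1, ⟨fun i => ?_, fun i => ?_, hbase⟩, fun i => ?_⟩
  · match i with
    | 0 => exact fun a b f => by simp only [hR0, mul_assoc]
    | 1 => exact fun a b f => by simp only [hR1, hψ, mul_assoc]
  · match i with
    | 0 => exact fun f => by simp only [hR0, mul_one]
    | 1 => exact fun f => by simp only [hR1, mul_one, Prod.mk.eta, hψ]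
  · match i with
    | 0 => exact hr
    | 1 => exact fun a f => by rw [← hr, hbase]

/-- The result of reading a sequence of syllables, one after the other. -/
def runList {F : Type*} (T : (Σ i, G i) → F → F) (L : List (Σ i, G i)) (z : F) : F :=
  L.foldl (fun z g => T g z) z

/-- Given a family `P` and a finite type `F` on which both factors act, with an equivariant map
`r` to the amalgamated subgroup, each factor `G i` acts on `Y × F`: diagonally over `P i`, and
over the other points, where only the amalgamated subgroup is known to act, through the cocycle
that `r` provides. -/
noncomputable def extAct (P : Fin 2 → Set Y) {F : Type*} (R : (Σ i, G i) → F → F) (r : F → A)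
    (s : Σ i, G i) (z : Y × F) : Y × F :=
  open Classical in
  (if z.1 ∈ P s.1 then (sylVal φ s)⁻¹ • z.1
    else (PushoutI.base φ ((r z.2)⁻¹ * r (R s z.2)))⁻¹ • z.1, R s z.2)

variable {P : Fin 2 → Set Y} {F : Type*} {R : (Σ i, G i) → F → F} {r : F → A}

lemma extAct_of_mem {s : Σ i, G i} {z : Y × F} (h : z.1 ∈ P s.1) :
    extAct (φ := φ) P R r s z = ((sylVal φ s)⁻¹ • z.1, R s z.2) := by
  simp [extAct, h]

lemma extAct_of_notMem {s : Σ i, G i} {z : Y × F} (h : z.1 ∉ P s.1) :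
    extAct (φ := φ) P R r s z =
      ((PushoutI.base φ ((r z.2)⁻¹ * r (R s z.2)))⁻¹ • z.1, R s z.2) := by
  simp [extAct, h]

lemma extAct_compatibleActions (hP : Invariant φ P) (hR : CompatibleActions φ R)
    (hr : ∀ i a f, r (R ⟨i, φ i a⟩ f) = r f * a) :
    CompatibleActions φ (extAct (φ := φ) P R r) := by
  refine ⟨fun i a b z => ?_, fun i z => ?_, fun a z => ?_⟩
  · by_cases h : z.1 ∈ P i
    · rw [extAct_of_mem h, extAct_of_mem (s := ⟨i, a⟩) h,
        extAct_of_mem (s := ⟨i, b⟩) (hP.inv ⟨i, a⟩ h), hR.map_mul, sylVal_mul, mul_inv_rev,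
        mul_smul]
    · have h' : ∀ c : A, (PushoutI.base φ c)⁻¹ • z.1 ∉ P i := fun c hc => h (by
        have := hP.base c hc
        rwa [smul_inv_smul] at this)
      rw [extAct_of_notMem h, extAct_of_notMem (s := ⟨i, a⟩) h,
        extAct_of_notMem (s := ⟨i, b⟩) (h' _), hR.map_mul, ← mul_smul, ← mul_inv_rev, ← map_mul]
      simp
  · by_cases h : z.1 ∈ P i
    · rw [extAct_of_mem h, hR.map_one]
      simp [sylVal]
    · rw [extAct_of_notMem h, hR.map_one]
      simp
  · have key : ∀ i, extAct (φ := φ) P R r ⟨i, φ i a⟩ z =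
        ((PushoutI.base φ a)⁻¹ • z.1, R ⟨i, φ i a⟩ z.2) := by
      intro i
      by_cases h : z.1 ∈ P i
      · rw [extAct_of_mem h, sylVal_base]
      · rw [extAct_of_notMem h, hr, inv_mul_cancel_left]
    rw [key, key, hR.map_base]

lemma extAct_mem (hP : Invariant φ P) (s : Σ i, G i) {z : Y × F} (hz : z.1 ∈ ⋃ i, P i) :
    (extAct (φ := φ) P R r s z).1 ∈ ⋃ i, P i := by
  by_cases h : z.1 ∈ P s.1
  · rw [extAct_of_mem h]
    exact Set.mem_iUnion.2 ⟨s.1, hP.inv s h⟩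
  · obtain ⟨i, hi⟩ := Set.mem_iUnion.1 hz
    rw [extAct_of_notMem h, ← map_inv]
    exact Set.mem_iUnion.2 ⟨i, hP.base _ hi⟩

lemma runList_extAct_fst {L : List (Σ i, G i)} {z : Y × F} (hL : Readable (φ := φ) P z.1 L) :
    (runList (extAct (φ := φ) P R r) L z).1 = (listVal φ L)⁻¹ • z.1 := by
  induction L generalizing z with
  | nil => simp [runList]
  | cons g L ih =>
    have e : extAct (φ := φ) P R r g z = ((sylVal φ g)⁻¹ • z.1, R g z.2) := extAct_of_mem hL.1
    have := ih (z := extAct (φ := φ) P R r g z) (by rw [e]; exact hL.2)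
    simp only [runList, List.foldl_cons] at this ⊢
    rw [this, e, listVal_cons, mul_inv_rev, mul_smul]

lemma runList_append {T : (Σ i, G i) → F → F} (L M : List (Σ i, G i)) (z : F) :
    runList T (L ++ M) z = runList T M (runList T L z) := by
  simp [runList]

lemma CompatibleActions.runList_invList (hR : CompatibleActions φ R) (L : List (Σ i, G i))
    (z : F) : runList R (invList L) (runList R L z) = z := by
  induction L generalizing z with
  | nil => rfl
  | cons g L ih =>
    have e : invList (g :: L) = invList L ++ [⟨g.1, g.2⁻¹⟩] := by simp [invList]
    have e' : runList R (g :: L) z = runList R L (R g z) := rfl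
    rw [e, runList_append, e', ih]
    have h := hR.map_mul g.1 g.2 g.2⁻¹ z
    rw [mul_inv_cancel, hR.map_one] at h
    exact h.symm

/-- Compatible right actions of the factors amount to a right action of the amalgam. -/
lemma CompatibleActions.exists_action (hR : CompatibleActions φ R) :
    ∃ ρ : PushoutI φ → F → F, (∀ z, ρ 1 z = z) ∧ (∀ x y z, ρ (x * y) z = ρ y (ρ x z)) ∧
      ∀ L z, ρ (listVal φ L) z = runList R L z := by
  let f : ∀ i, G i →* (Function.End F)ᵐᵒᵖ := fun i =>
    { toFun := fun a => MulOpposite.op (R ⟨i, a⟩)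
      map_one' := congrArg MulOpposite.op (funext fun z => hR.map_one i z)
      map_mul' := fun a b => congrArg MulOpposite.op (funext fun z => hR.map_mul i a b z) }
  have hf : ∀ i, (f i).comp (φ i) = (f 0).comp (φ 0) := by
    intro i
    match i with
    | 0 => rfl
    | 1 => exact MonoidHom.ext fun a =>
        congrArg MulOpposite.op (funext fun z => (hR.map_base a z).symm)
  let ρ : PushoutI φ → F → F := fun x => (PushoutI.lift f _ hf x).unop
  have h1 : ∀ z, ρ 1 z = z := fun z =>
    congrFun (congrArg MulOpposite.unop (MonoidHom.map_one (PushoutI.lift f _ hf))) z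
  have hmul : ∀ x y z, ρ (x * y) z = ρ y (ρ x z) := fun x y z =>
    congrFun (congrArg MulOpposite.unop (MonoidHom.map_mul (PushoutI.lift f _ hf) x y)) z
  refine ⟨ρ, h1, hmul, fun L => ?_⟩
  induction L with
  | nil => exact h1
  | cons g L ih =>
    intro z
    have hg : ρ (sylVal φ g) z = R g z :=
      congrFun (congrArg MulOpposite.unop (PushoutI.lift_of _ _ hf g.2)) z
    rw [listVal_cons, hmul, ih, hg]
    rfl

end Extension

/-! ### Separating a word from a subgroup by finite actions -/

section Separation

universe u v w x y

variable {A : Type u} {G : Fin 2 → Type v} [Group A] [∀ i, Group (G i)]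
  {φ : ∀ i, A →* G i} {X : Type x} {gen : X → Σ i, G i}

/-- `Separates φ gen hs s R μ`: the finite actions `R` with the marking `μ` of the points show that
`s` does not represent an element of the subgroup generated by `hs`, because `μ` is invariant
under `hs` but not under `s`. -/
structure Separates (φ : ∀ i, A →* G i) (gen : X → Σ i, G i) (hs : List (List (X × Bool)))
    (s : List (X × Bool)) {F : Type*} (R : (Σ i, G i) → F → F) (μ : F → ℕ) : Prop where
  compatible : CompatibleActions φ R
  invariant : ∀ h ∈ hs, ∀ z, μ (runList R (h.map (letterSyl gen)) z) = μ z
  moved : ∃ z, μ (runList R (s.map (letterSyl gen)) z) ≠ μ z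

lemma Separates.notMem {hs : List (List (X × Bool))} {s : List (X × Bool)} {F : Type*}
    {R : (Σ i, G i) → F → F} {μ : F → ℕ} (h : Separates φ gen hs s R μ) :
    wordVal φ gen s ∉ genSubgroup φ gen hs := by
  intro hmem
  obtain ⟨ρ, h1, hmul, hρ⟩ := h.compatible.exists_action
  have key : ∀ g ∈ genSubgroup φ gen hs, ∀ z, μ (ρ g z) = μ z := by
    intro g hg
    induction hg using Subgroup.closure_induction with
    | mem g hg =>
      obtain ⟨t, ht, rfl⟩ := hg
      intro z
      rw [← listVal_map_letterSyl, hρ, h.invariant t ht]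
    | one => intro z; rw [h1]
    | mul a b _ _ ha hb => intro z; rw [hmul, hb, ha]
    | inv a _ ha => intro z; rw [← ha, ← hmul, inv_mul_cancel, h1]
  obtain ⟨z, hz⟩ := h.moved
  have := key _ hmem z
  rw [← listVal_map_letterSyl, hρ] at this
  exact hz this

/-- Every word outside a finitely generated subgroup is separated from it by actions on a set
whose size is bounded in terms of the words. -/
lemma exists_separates [∀ i, Finite (G i)] (hφ : ∀ i, Function.Injective (φ i))
    {hs : List (List (X × Bool))} {s : List (X × Bool)}
    (h : wordVal φ gen s ∉ genSubgroup φ gen hs) :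
    ∃ n ≤ prefixBound G (s :: hs) * Nat.card (G 0 × G 1),
      ∃ (R : (Σ i, G i) → Fin n → Fin n) (μ : Fin n → ℕ),
        (∀ z, μ z < n) ∧ Separates φ gen hs s R μ := by
  classical
  let y₀ : PushoutI φ ⧸ genSubgroup φ gen hs := (1 : PushoutI φ)
  have hy₀ : ∀ h : PushoutI φ, h • y₀ = y₀ ↔ h ∈ genSubgroup φ gen hs :=
    smul_one_coset_eq_iff _
  set P := prefixFamily φ gen y₀ (s :: hs) with hP
  have hinv : Invariant φ P := prefixFamily_invariant _ _
  obtain ⟨Z, hZ, hZc, hPZ⟩ := exists_prefixFamily_subset (φ := φ) (gen := gen) y₀ (s :: hs)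
  obtain ⟨R, r, hR, hr⟩ := exists_compatibleActions hφ
  have hT := extAct_compatibleActions hinv hR hr
  set T := extAct (φ := φ) P R r
  have hQ : ⋃ i, P i ⊆ Z := Set.iUnion_subset hPZ
  have hfin : Finite ↥(⋃ i, P i) := (hZ.subset hQ).to_subtype
  have hbase : y₀ ∈ ⋃ i, P i := Set.mem_iUnion.2 ⟨0, by
    simpa using mem_prefixFamily (φ := φ) (gen := gen) (hs := s :: hs) y₀ (Or.inl rfl) 0⟩
  -- The action restricted to the finite set of points over the family.
  let T' : (Σ i, G i) → ↥(⋃ i, P i) × (G 0 × G 1) → ↥(⋃ i, P i) × (G 0 × G 1) := fun g z =>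
    (⟨(T g (z.1.1, z.2)).1, extAct_mem hinv g z.1.2⟩, (T g (z.1.1, z.2)).2)
  let j : ↥(⋃ i, P i) × (G 0 × G 1) → (PushoutI φ ⧸ genSubgroup φ gen hs) × (G 0 × G 1) :=
    fun z => (z.1.1, z.2)
  let e := Finite.equivFin (↥(⋃ i, P i) × (G 0 × G 1))
  let R' : (Σ i, G i) → Fin _ → Fin _ := fun g k => e (T' g (e.symm k))
  let k : Fin _ → (PushoutI φ ⧸ genSubgroup φ gen hs) × (G 0 × G 1) := fun z => j (e.symm z)
  have hk : Function.Injective k := by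
    intro a b hab
    refine e.symm.injective (Prod.ext (Subtype.ext ?_) ?_)
    · have h1 : (k a).1 = (k b).1 := by rw [hab]
      exact h1
    · have h2 : (k a).2 = (k b).2 := by rw [hab]
      exact h2
  have hkR : ∀ g z, k (R' g z) = T g (k z) := fun g z => by simp [k, R', j, T']
  have hkrun : ∀ L z, k (runList R' L z) = runList T L (k z) := by
    intro L
    induction L with
    | nil => intro z; rfl
    | cons g L ih =>
      intro z
      have := ih (R' g z)
      rw [hkR] at this
      exact this
  have hread : ∀ t ∈ s :: hs, Readable (φ := φ) P y₀ (t.map (letterSyl gen)) :=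
    fun t ht => prefixFamily_readable y₀ ⟨t, ht, List.prefix_rfl⟩
  have hmoved : (wordVal φ gen s)⁻¹ • y₀ ≠ y₀ := fun hcon =>
    h ((hy₀ _).1 (eq_inv_smul_iff.1 hcon.symm))
  have hsP : (wordVal φ gen s)⁻¹ • y₀ ∈ ⋃ i, P i :=
    Set.mem_iUnion.2 ⟨0, mem_prefixFamily y₀ (Or.inr ⟨s, by simp, List.prefix_rfl⟩) 0⟩
  have hcard : 2 ≤ Nat.card (↥(⋃ i, P i) × (G 0 × G 1)) := by
    have : Nontrivial (↥(⋃ i, P i) × (G 0 × G 1)) :=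
      ⟨(⟨_, hsP⟩, 1), (⟨_, hbase⟩, 1), fun hcon => hmoved (by simpa using hcon)⟩
    exact Finite.one_lt_card
  refine ⟨_, ?_, R', fun z => if (k z).1 = y₀ then 0 else 1, fun z => ?_, ?_, ?_, ?_⟩
  · rw [Nat.card_prod]
    exact Nat.mul_le_mul_right _ ((Set.ncard_le_ncard hQ hZ).trans hZc)
  · dsimp only
    split_ifs <;> omega
  · refine ⟨fun i a b z => hk ?_, fun i z => hk ?_, fun a z => hk ?_⟩
    · rw [hkR, hkR, hkR, hT.map_mul]
    · rw [hkR, hT.map_one]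
    · rw [hkR, hkR, hT.map_base]
  · intro t ht z
    have ht' := hread t (by simp [ht])
    have hfix : (listVal φ (t.map (letterSyl gen)))⁻¹ • y₀ = y₀ := by
      rw [listVal_map_letterSyl]
      exact inv_smul_eq_iff.2 ((hy₀ _).2 (Subgroup.subset_closure ⟨t, ht, rfl⟩)).symm
    have hinvL := ht'.invList hinv
    rw [hfix] at hinvL
    have hiff : (k (runList R' (t.map (letterSyl gen)) z)).1 = y₀ ↔ (k z).1 = y₀ := by
      rw [hkrun]
      constructor
      · intro hz
        have h1 := hT.runList_invList (t.map (letterSyl gen)) (k z)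
        rw [← h1, runList_extAct_fst (by rw [hz]; exact hinvL), hz, listVal_invList, inv_inv]
        exact (inv_smul_eq_iff.1 hfix).symm
      · intro hz
        rw [runList_extAct_fst (by rw [hz]; exact ht'), hz, hfix]
    simp only [hiff]
  · refine ⟨e (⟨y₀, hbase⟩, 1), ?_⟩
    have hz : (k (e (⟨y₀, hbase⟩, 1))).1 = y₀ := by simp [k, j]
    have : (k (runList R' (s.map (letterSyl gen)) (e (⟨y₀, hbase⟩, 1)))).1 ≠ y₀ := by
      rw [hkrun, runList_extAct_fst (by rw [hz]; exact hread s (by simp)), hz,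
        listVal_map_letterSyl]
      exact hmoved
    simp [this, hz]

end Separation

/-! ### Primitive recursive predicates -/

section Recursive

variable {α β : Type*} [Primcodable α] [Primcodable β]

lemma primrecPred_forall_mem {R : α → β → Prop}
    (hR : PrimrecPred fun q : α × β => R q.1 q.2) {L : α → List β} (hL : Primrec L) :
    PrimrecPred fun a => ∀ x ∈ L a, R a x := by
  have hR' : PrimrecRel fun (x : β) (a : α) => R a x :=
    hR.comp (Primrec.snd.pair Primrec.fst)
  exact hR'.forall_mem_list.comp hL Primrec.id

lemma primrecPred_forall_lt {R : α → ℕ → Prop} (hR : PrimrecPred fun q : α × ℕ => R q.1 q.2)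
    {B : α → ℕ} (hB : Primrec B) : PrimrecPred fun a => ∀ x < B a, R a x :=
  (primrecPred_forall_mem hR (Primrec.list_range.comp hB)).of_eq (by simp)

lemma primrecPred_exists_lt {R : α → ℕ → Prop} (hR : PrimrecPred fun q : α × ℕ => R q.1 q.2)
    {B : α → ℕ} (hB : Primrec B) : PrimrecPred fun a => ∃ x < B a, R a x :=
  (primrecPred_forall_lt (R := fun a x => ¬ R a x) hR.not hB).not.of_eq (by simp)

lemma primrec_pow : Primrec₂ fun m n : ℕ => m ^ n :=
  Primrec₂.unpaired'.1 Nat.Primrec.pow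

/-- Bounded search for the least number with a primitive recursive property. -/
lemma exists_primrec_isLeast {R : α → ℕ → Prop}
    (hR : PrimrecPred fun q : α × ℕ => R q.1 q.2) {B : α → ℕ} (hB : Primrec B) :
    ∃ f : α → Option ℕ, Primrec f ∧ ∀ a n, f a = some n ↔ IsLeast {n | n < B a ∧ R a n} n := by
  classical
  have hfind : Primrec fun a => (List.range (B a)).findIdx fun n => decide (R a n) :=
    Primrec.list_findIdx (Primrec.list_range.comp hB) hR.decide
  have hlt : PrimrecPred fun a =>
      (List.range (B a)).findIdx (fun n => decide (R a n)) < B a :=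
    Primrec.nat_lt.comp hfind hB
  refine ⟨fun a => if (List.range (B a)).findIdx (fun n => decide (R a n)) < B a then
      some ((List.range (B a)).findIdx fun n => decide (R a n)) else none,
    Primrec.ite hlt (Primrec.option_some.comp hfind) (Primrec.const none), fun a n => ?_⟩
  set k := (List.range (B a)).findIdx fun n => decide (R a n) with hk
  have hnot : ∀ j < k, ¬ R a j := by
    intro j hj
    have := List.not_of_lt_findIdx hj
    simpa using this
  have hspec : k < B a → R a k := by
    intro h
    have h' : k < (List.range (B a)).length := by simpa using h
    have := List.findIdx_getElem (w := h')
    simpa using this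
  have hle : ∀ j, j < B a → R a j → k ≤ j := fun j _ hj => not_lt.1 fun h => hnot j h hj
  dsimp only
  rw [← hk]
  split_ifs with h
  · rw [Option.some_inj]
    constructor
    · rintro rfl
      exact ⟨⟨h, hspec h⟩, fun j hj => hle j hj.1 hj.2⟩
    · intro hn
      exact le_antisymm (hle n hn.1.1 hn.1.2) (hn.2 ⟨h, hspec h⟩)
  · simp only [false_iff]
    intro hn
    exact h ((hle n hn.1.1 hn.1.2).trans_lt hn.1.1)

/-- A family of functions on the numbers below `n`, given by the digits of `c` to the base `n`. -/
def row (n c e i : ℕ) : ℕ := c / n ^ (e * n + i) % n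

/-- Successive application of the functions in the table `c`. -/
def run (n c : ℕ) (L : List ℕ) (i : ℕ) : ℕ := L.foldl (fun i e => row n c e i) i

lemma row_lt {n : ℕ} (hn : 0 < n) (c e i : ℕ) : row n c e i < n := Nat.mod_lt _ hn

lemma primrec_row {n c e i : α → ℕ} (hn : Primrec n) (hc : Primrec c) (he : Primrec e)
    (hi : Primrec i) : Primrec fun a => row (n a) (c a) (e a) (i a) :=
  Primrec.nat_mod.comp (Primrec.nat_div.comp hc (primrec_pow.comp hn
    (Primrec.nat_add.comp (Primrec.nat_mul.comp he hn) hi))) hn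

lemma primrec_run {n c i : α → ℕ} {L : α → List ℕ} (hn : Primrec n) (hc : Primrec c)
    (hL : Primrec L) (hi : Primrec i) : Primrec fun a => run (n a) (c a) (L a) (i a) :=
  Primrec.list_foldl (h := fun a q => row (n a) (c a) q.2 q.1) hL hi
    (primrec_row (hn.comp .fst) (hc.comp .fst) (Primrec.snd.comp .snd) (Primrec.fst.comp .snd))

lemma exists_row_eq {n m : ℕ} (d : Fin m → Fin n → Fin n) :
    ∃ c < n ^ (n * m), ∀ (e : Fin m) (i : Fin n), row n c e i = d e i := by
  let d' : Fin (n * m) → Fin n := fun k =>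
    have hn : 0 < n := Nat.pos_of_mul_pos_right (Nat.zero_lt_of_lt k.2)
    d ⟨k / n, Nat.div_lt_of_lt_mul k.2⟩ ⟨k % n, Nat.mod_lt _ hn⟩
  refine ⟨finFunctionFinEquiv d', (finFunctionFinEquiv d').2, fun e i => ?_⟩
  have hn : 0 < n := Nat.zero_lt_of_lt i.2
  have hlt : (e : ℕ) * n + i < n * m := by
    calc (e : ℕ) * n + i < e * n + n := by omega
      _ = n * (e + 1) := by ring
      _ ≤ n * m := Nat.mul_le_mul_left _ e.2
  have h := finFunctionFinEquiv_symm_apply_val (finFunctionFinEquiv d') ⟨_, hlt⟩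
  rw [Equiv.symm_apply_apply] at h
  rw [row, ← h]
  have h1 : ((e : ℕ) * n + i) / n = e := by
    rw [mul_comm, Nat.mul_add_div hn, Nat.div_eq_of_lt i.2, add_zero]
  have h2 : ((e : ℕ) * n + i) % n = i := by
    rw [mul_comm, Nat.mul_add_mod, Nat.mod_eq_of_lt i.2]
  simp only [d', h1, h2]

end Recursive

/-! ### The algorithm -/

section Algorithm

universe u v

variable {A : Type u} {G : Fin 2 → Type v} [Group A] [∀ i, Group (G i)]
  {φ : ∀ i, A →* G i} {N : ℕ} {gen : Fin N → Σ i, G i}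

/-- `IsCertificate code m rels hs s n c`: the table `c` satisfies the relations `rels`, and its row
number `m` is a marking which is invariant under the words `hs`, but not under `s`. -/
def IsCertificate (code : Fin N × Bool → ℕ) (m : ℕ) (rels : List (List ℕ × List ℕ))
    (hs : List (List (Fin N × Bool))) (s : List (Fin N × Bool)) (n c : ℕ) : Prop :=
  (∀ q ∈ rels, ∀ i < n, run n c q.1 i = run n c q.2 i) ∧
  (∀ h ∈ hs, ∀ i < n, row n c m (run n c (h.map code) i) = row n c m i) ∧
  ∃ i < n, row n c m (run n c (s.map code) i) ≠ row n c m i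

lemma primrecPred_isCertificate (code : Fin N × Bool → ℕ) (m : ℕ)
    (rels : List (List ℕ × List ℕ)) :
    PrimrecPred fun p : ((List (List (Fin N × Bool)) × List (Fin N × Bool)) × ℕ) × ℕ =>
      IsCertificate code m rels p.1.1.1 p.1.1.2 p.1.2 p.2 := by
  have hcode : Primrec fun s : List (Fin N × Bool) => s.map code :=
    Primrec.list_map Primrec.id ((Primrec.dom_finite code).comp Primrec.snd)
  have hn : Primrec fun p : ((List (List (Fin N × Bool)) × List (Fin N × Bool)) × ℕ) × ℕ =>
      p.1.2 := Primrec.snd.comp .fst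
  have hc : Primrec fun p : ((List (List (Fin N × Bool)) × List (Fin N × Bool)) × ℕ) × ℕ =>
      p.2 := .snd
  refine PrimrecPred.and ?_ (PrimrecPred.and ?_ ?_)
  · refine primrecPred_forall_mem ?_ (Primrec.const rels)
    refine primrecPred_forall_lt ?_ (hn.comp .fst)
    refine Primrec.eq.comp ?_ ?_
    all_goals
      refine primrec_run (hn.comp (Primrec.fst.comp .fst))
        (hc.comp (Primrec.fst.comp .fst)) ?_ .snd
    · exact Primrec.fst.comp (Primrec.snd.comp .fst)
    · exact Primrec.snd.comp (Primrec.snd.comp .fst)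
  · refine primrecPred_forall_mem ?_ (Primrec.fst.comp (Primrec.fst.comp .fst))
    refine primrecPred_forall_lt ?_ (hn.comp .fst)
    refine Primrec.eq.comp ?_ ?_
    all_goals
      refine primrec_row (hn.comp (Primrec.fst.comp .fst))
        (hc.comp (Primrec.fst.comp .fst)) (Primrec.const m) ?_
    · exact primrec_run (hn.comp (Primrec.fst.comp .fst)) (hc.comp (Primrec.fst.comp .fst))
        (hcode.comp (Primrec.snd.comp .fst)) .snd
    · exact .snd
  · refine primrecPred_exists_lt ?_ hn
    refine PrimrecPred.not (Primrec.eq.comp ?_ ?_)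
    all_goals
      refine primrec_row (hn.comp .fst) (hc.comp .fst) (Primrec.const m) ?_
    · exact primrec_run (hn.comp .fst) (hc.comp .fst) (hcode.comp
        (Primrec.snd.comp (Primrec.fst.comp (Primrec.fst.comp .fst)))) .snd
    · exact .snd

/-- If the rows of the table `c` describe the functions `R` and the marking `μ`, then being a
certificate means that `R` and `μ` separate the word from the subgroup. -/
lemma isCertificate_iff {m : ℕ} (idx : (Σ i, G i) ≃ Fin m) {rels : List (List ℕ × List ℕ)}
    (hrels : ∀ q, q ∈ rels ↔
      (∃ (i : Fin 2) (a b : G i),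
        q = ([(idx ⟨i, a⟩ : ℕ), idx ⟨i, b⟩], [(idx ⟨i, a * b⟩ : ℕ)])) ∨
      (∃ i : Fin 2, q = ([(idx ⟨i, 1⟩ : ℕ)], [])) ∨
      ∃ a : A, q = ([(idx ⟨0, φ 0 a⟩ : ℕ)], [(idx ⟨1, φ 1 a⟩ : ℕ)]))
    {hs : List (List (Fin N × Bool))} {s : List (Fin N × Bool)} {n c : ℕ}
    {R : (Σ i, G i) → Fin n → Fin n} {μ : Fin n → ℕ}
    (hR : ∀ g (i : Fin n), row n c (idx g) i = R g i) (hμ : ∀ i : Fin n, row n c m i = μ i) :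
    IsCertificate (fun l => (idx (letterSyl gen l) : ℕ)) m rels hs s n c ↔
      Separates φ gen hs s R μ := by
  have hrun : ∀ (L : List (Σ i, G i)) (i : Fin n),
      run n c (L.map fun g => (idx g : ℕ)) i = runList R L i := by
    intro L
    induction L with
    | nil => intro i; rfl
    | cons g L ih =>
      intro i
      have := ih (R g i)
      rw [← hR] at this
      exact this
  have hword : ∀ (t : List (Fin N × Bool)) (i : Fin n),
      run n c (t.map fun l => (idx (letterSyl gen l) : ℕ)) i =
        runList R (t.map (letterSyl gen)) i := by
    intro t i
    rw [← hrun, List.map_map]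
    rfl
  have h1 : (∀ q ∈ rels, ∀ i < n, run n c q.1 i = run n c q.2 i) ↔ CompatibleActions φ R := by
    have hmul := fun (i : Fin 2) (a b : G i) => hrun [⟨i, a⟩, ⟨i, b⟩]
    have hone := fun (g : Σ i, G i) => hrun [g]
    constructor
    · intro h
      refine ⟨fun i a b z => Fin.ext ?_, fun i z => Fin.ext ?_, fun a z => Fin.ext ?_⟩
      · have := h _ ((hrels _).2 (Or.inl ⟨i, a, b, rfl⟩)) z z.2
        exact ((hone ⟨i, a * b⟩ z).symm.trans this.symm).trans (hmul i a b z)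
      · have := h _ ((hrels _).2 (Or.inr (Or.inl ⟨i, rfl⟩))) z z.2
        exact (hone ⟨i, 1⟩ z).symm.trans this
      · have := h _ ((hrels _).2 (Or.inr (Or.inr ⟨a, rfl⟩))) z z.2
        exact ((hone ⟨0, φ 0 a⟩ z).symm.trans this).trans (hone ⟨1, φ 1 a⟩ z)
    · intro h q hq i hi
      rcases (hrels q).1 hq with ⟨k, a, b, rfl⟩ | ⟨k, rfl⟩ | ⟨a, rfl⟩
      · exact (hmul k a b ⟨i, hi⟩).trans ((congrArg Fin.val (h.map_mul k a b ⟨i, hi⟩)).symm.trans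
          (hone ⟨k, a * b⟩ ⟨i, hi⟩).symm)
      · exact (hone ⟨k, 1⟩ ⟨i, hi⟩).trans (congrArg Fin.val (h.map_one k ⟨i, hi⟩))
      · exact (hone ⟨0, φ 0 a⟩ ⟨i, hi⟩).trans ((congrArg Fin.val (h.map_base a ⟨i, hi⟩)).trans
          (hone ⟨1, φ 1 a⟩ ⟨i, hi⟩).symm)
  have hmark : ∀ (t : List (Fin N × Bool)) (i : Fin n),
      row n c m (run n c (t.map fun l => (idx (letterSyl gen l) : ℕ)) i) = row n c m i ↔
        μ (runList R (t.map (letterSyl gen)) i) = μ i := by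
    intro t i
    rw [hword, hμ, hμ]
  constructor
  · rintro ⟨h, h2, i, hi, h3⟩
    exact ⟨h1.1 h, fun t ht z => (hmark t z).1 (h2 t ht z z.2),
      ⟨i, hi⟩, fun hcon => h3 ((hmark s ⟨i, hi⟩).2 hcon)⟩
  · rintro ⟨h, h2, z, h3⟩
    exact ⟨h1.2 h, fun t ht i hi => (hmark t ⟨i, hi⟩).2 (h2 t ht _),
      z, z.2, fun hcon => h3 ((hmark s z).1 hcon)⟩

lemma primrec_prefixBound (G : Fin 2 → Type v) :
    Primrec fun hs : List (List (Fin N × Bool)) => prefixBound G hs :=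
  Primrec.nat_mul.comp (Primrec.const _) (Primrec.succ.comp (Primrec.nat_mul.comp
    Primrec.list_length (Primrec.succ.comp (Primrec.list_length.comp Primrec.list_flatten))))

/-- Membership in finitely generated subgroups is primitive recursive: a word lies outside the
subgroup if and only if some certificate below an explicit bound shows this. -/
theorem primrecPred_mem_genSubgroup [∀ i, Finite (G i)] (hφ : ∀ i, Function.Injective (φ i)) :
    PrimrecPred fun p : List (List (Fin N × Bool)) × List (Fin N × Bool) =>
      wordVal φ gen p.2 ∈ genSubgroup φ gen p.1 := by
  have hA : Finite A := Finite.of_injective _ (hφ 0)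
  obtain ⟨m, ⟨idx⟩⟩ := Finite.exists_equiv_fin (Σ i, G i)
  obtain ⟨rels, hrels⟩ : ∃ rels : List (List ℕ × List ℕ), ∀ q, q ∈ rels ↔
      (∃ (i : Fin 2) (a b : G i),
        q = ([(idx ⟨i, a⟩ : ℕ), idx ⟨i, b⟩], [(idx ⟨i, a * b⟩ : ℕ)])) ∨
      (∃ i : Fin 2, q = ([(idx ⟨i, 1⟩ : ℕ)], [])) ∨
      ∃ a : A, q = ([(idx ⟨0, φ 0 a⟩ : ℕ)], [(idx ⟨1, φ 1 a⟩ : ℕ)]) := by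
    have hfin := ((Set.finite_range fun z : Σ i, G i × G i =>
      ([(idx ⟨z.1, z.2.1⟩ : ℕ), (idx ⟨z.1, z.2.2⟩ : ℕ)], [(idx ⟨z.1, z.2.1 * z.2.2⟩ : ℕ)])).union
      ((Set.finite_range fun i : Fin 2 => ([(idx ⟨i, 1⟩ : ℕ)], ([] : List ℕ))).union
      (Set.finite_range fun a : A => ([(idx ⟨0, φ 0 a⟩ : ℕ)], [(idx ⟨1, φ 1 a⟩ : ℕ)]))))
    refine ⟨hfin.toFinset.toList, fun q => ?_⟩
    simp only [Finset.mem_toList, Set.Finite.mem_toFinset, Set.mem_union, Set.mem_range,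
      Sigma.exists, Prod.exists, eq_comm (b := q)]
  have hcert := primrecPred_isCertificate (fun l => (idx (letterSyl gen l) : ℕ)) m rels
  have hB : Primrec fun p : List (List (Fin N × Bool)) × List (Fin N × Bool) =>
      prefixBound G (p.2 :: p.1) * Nat.card (G 0 × G 1) + 1 :=
    Primrec.succ.comp (Primrec.nat_mul.comp ((primrec_prefixBound G).comp
      (Primrec.list_cons.comp .snd .fst)) (Primrec.const _))
  have hC : Primrec fun p : (List (List (Fin N × Bool)) × List (Fin N × Bool)) × ℕ =>
      p.2 ^ (p.2 * (m + 1)) :=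
    primrec_pow.comp .snd (Primrec.nat_mul.comp .snd (Primrec.const _))
  refine (primrecPred_exists_lt (R := fun p n => ∃ c < n ^ (n * (m + 1)),
    IsCertificate (fun l => (idx (letterSyl gen l) : ℕ)) m rels p.1 p.2 n c)
    (primrecPred_exists_lt hcert hC) hB).not.of_eq ?_
  rintro ⟨hs, s⟩
  rw [not_iff_comm]
  constructor
  · intro h
    obtain ⟨n, hn, R, μ, hμ, hsep⟩ := exists_separates hφ h
    obtain ⟨c, hc, hrow⟩ := exists_row_eq (m := m + 1)
      (Fin.lastCases (fun i => ⟨μ i, hμ i⟩) fun e => R (idx.symm e))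
    refine ⟨n, Nat.lt_succ_of_le hn, c, hc, ?_⟩
    refine (isCertificate_iff idx hrels (fun g i => ?_) fun i => ?_).2 hsep
    · have := hrow (idx g).castSucc i
      simpa using this
    · have := hrow (Fin.last m) i
      simpa using this
  · rintro ⟨n, -, c, -, h⟩
    have hn : 0 < n := by
      obtain ⟨i, hi, -⟩ := h.2.2
      omega
    exact ((isCertificate_iff idx hrels (R := fun g i => ⟨row n c (idx g) i, row_lt hn _ _ _⟩)
      (μ := fun i => row n c m i) (fun _ _ => rfl) (fun _ => rfl)).1 h).notMem

lemma wordVal_powList (s : List (Fin N × Bool)) (n : ℕ) :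
    wordVal φ gen (powList s n) = wordVal φ gen s ^ n := by
  induction n with
  | zero => simp [powList]
  | succ n ih => rw [powList_succ, wordVal_append, ih, pow_succ']

lemma primrec_powList : Primrec₂ fun (s : List (Fin N × Bool)) (n : ℕ) => powList s n := by
  have h : Primrec₂ fun (s : List (Fin N × Bool)) (n : ℕ) =>
      (List.range n).flatMap fun _ => s :=
    Primrec.list_flatMap (Primrec.list_range.comp .snd) (Primrec.fst.comp .fst)
  refine h.of_eq fun s n => ?_
  rw [List.flatMap_def, powList]
  simp

/-- If some power of an element is a nontrivial element of the subgroup, then this holds for an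
exponent below an explicit bound. -/
lemma exists_pow_mem_lt [∀ i, Finite (G i)] (hφ : ∀ i, Function.Injective (φ i))
    (hs : List (List (Fin N × Bool))) {g : PushoutI φ} {n : ℕ} (hn : 1 ≤ n)
    (hgn : g ^ n ∈ genSubgroup φ gen hs) (h1 : g ^ n ≠ 1) :
    ∃ z < prefixBound G hs + Nat.card (Σ i, G i) + 1,
      1 ≤ z ∧ g ^ z ∈ genSubgroup φ gen hs ∧ g ^ z ≠ 1 := by
  by_cases hg : IsOfFinOrder g
  · obtain ⟨u, s, rfl⟩ := exists_conj_of_isOfFinOrder hφ hg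
    have hpow := conj_sylVal_pow_card u s
    have hmod : (u * sylVal φ s * u⁻¹) ^ (n % Nat.card (G s.1)) =
        (u * sylVal φ s * u⁻¹) ^ n := by
      conv_rhs => rw [← Nat.mod_add_div n (Nat.card (G s.1)), pow_add, pow_mul, hpow, one_pow,
        mul_one]
    refine ⟨n % Nat.card (G s.1), ?_, ?_, by rwa [hmod], by rwa [hmod]⟩
    · have h2 : n % Nat.card (G s.1) < Nat.card (G s.1) := Nat.mod_lt _ Nat.card_pos
      have h3 : Nat.card (G s.1) ≤ Nat.card (Σ i, G i) :=
        Nat.card_le_card_of_injective (fun a => (⟨s.1, a⟩ : Σ i, G i)) sigma_mk_injective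
      omega
    · by_contra hcon
      refine h1 ?_
      rw [← hmod, Nat.lt_one_iff.1 (not_le.1 hcon), pow_zero]
  · let y₀ : PushoutI φ ⧸ genSubgroup φ gen hs := (1 : PushoutI φ)
    have hy₀ : ∀ h : PushoutI φ, h • y₀ = y₀ ↔ h ∈ genSubgroup φ gen hs :=
      smul_one_coset_eq_iff _
    have hS := prefixFamily_supports hy₀
    obtain ⟨Z, hZ, hZc, hPZ⟩ := exists_prefixFamily_subset (φ := φ) (gen := gen) y₀ hs
    obtain ⟨z, hz1, hz2, hz3⟩ := exists_pow_smul_eq hφ hS.invariant hZ hPZ hS.read hg hn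
      ((hy₀ _).2 hgn)
    refine ⟨z, by omega, hz1, (hy₀ _).1 hz3, fun hcon => ?_⟩
    exact hg (isOfFinOrder_iff_pow_eq_one.2 ⟨z, hz1, hcon⟩)

end Algorithm

end AmalgamGraph

theorem mainTheorem11 {A : Type*} {G : Fin 2 → Type*} [Group A] [∀ i, Group (G i)]
    [∀ i, Finite (G i)] (φ : ∀ i, A →* G i) (hφ : ∀ i, Function.Injective (φ i))
    {N : ℕ} (gen : Fin N → Σ i, G i)
    (hgen : ∀ i, Subgroup.closure {a : G i | (⟨i, a⟩ : Σ i, G i) ∈ Set.range gen} = ⊤) :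
    -- the subgroup graph exists, and its number of vertices bounds the minimal power
    (∀ H : Subgroup (Monoid.PushoutI φ), H.FG →
      (∃ (V : Type) (Γ : AmalgamGraph.LabelledGraph (Fin N) V) (v₀ : V),
        AmalgamGraph.IsSubgroupGraph φ gen H Γ v₀) ∧
      ∀ (V : Type*) (Γ : AmalgamGraph.LabelledGraph (Fin N) V) (v₀ : V),
        AmalgamGraph.IsSubgroupGraph φ gen H Γ v₀ →
        ∀ g : Monoid.PushoutI φ, ¬ IsOfFinOrder g → (∃ n : ℕ, 1 ≤ n ∧ g ^ n ∈ H) →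
          ∃ z : ℕ, 1 ≤ z ∧ z ≤ Nat.card V ∧ g ^ z ∈ H) ∧
    -- an algorithm finds the minimal exponent of a nontrivial power in the subgroup, if any
    (∃ f : List (List (Fin N × Bool)) × List (Fin N × Bool) → Option ℕ, Computable f ∧
      ∀ hs s n, f (hs, s) = some n ↔
        IsLeast {n : ℕ | 1 ≤ n ∧
          AmalgamGraph.wordVal φ gen s ^ n ∈ AmalgamGraph.genSubgroup φ gen hs ∧
          AmalgamGraph.wordVal φ gen s ^ n ≠ 1} n) := by
  refine ⟨fun H hH => ⟨AmalgamGraph.exists_isSubgroupGraph hφ hgen hH, ?_⟩, ?_⟩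
  · rintro V Γ v₀ ⟨hV, hΓ, hlab⟩ g hg ⟨n, hn, hgn⟩
    exact AmalgamGraph.exists_pow_mem_le_card hφ hgen hΓ.1 hlab hg hn hgn
  · have hmem := AmalgamGraph.primrecPred_mem_genSubgroup (gen := gen) hφ
    have hword : Primrec fun q : (List (List (Fin N × Bool)) × List (Fin N × Bool)) × ℕ =>
        AmalgamGraph.powList q.1.2 q.2 :=
      AmalgamGraph.primrec_powList.comp (Primrec.snd.comp .fst) .snd
    -- A word is trivial if and only if it lies in the subgroup generated by no words at all.
    have hR : PrimrecPred fun q : (List (List (Fin N × Bool)) × List (Fin N × Bool)) × ℕ =>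
        1 ≤ q.2 ∧ AmalgamGraph.wordVal φ gen q.1.2 ^ q.2 ∈ AmalgamGraph.genSubgroup φ gen q.1.1 ∧
          AmalgamGraph.wordVal φ gen q.1.2 ^ q.2 ≠ 1 := by
      refine ((Primrec.nat_le.comp (Primrec.const 1) Primrec.snd).and
        ((hmem.comp ((Primrec.fst.comp .fst).pair hword)).and
          (hmem.comp ((Primrec.const []).pair hword)).not)).of_eq fun q => ?_
      simp [AmalgamGraph.wordVal_powList, AmalgamGraph.genSubgroup]
    have hB : Primrec fun p : List (List (Fin N × Bool)) × List (Fin N × Bool) =>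
        AmalgamGraph.prefixBound G p.1 + Nat.card (Σ i, G i) + 1 :=
      Primrec.succ.comp (Primrec.nat_add.comp
        ((AmalgamGraph.primrec_prefixBound G).comp Primrec.fst)
        (Primrec.const (Nat.card (Σ i, G i))))
    obtain ⟨f, hf, hfspec⟩ := AmalgamGraph.exists_primrec_isLeast
      (R := fun (p : List (List (Fin N × Bool)) × List (Fin N × Bool)) (n : ℕ) => 1 ≤ n ∧
        AmalgamGraph.wordVal φ gen p.2 ^ n ∈ AmalgamGraph.genSubgroup φ gen p.1 ∧
        AmalgamGraph.wordVal φ gen p.2 ^ n ≠ 1) hR hB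
    refine ⟨f, hf.to_comp, fun hs s n => (hfspec (hs, s) n).trans ⟨fun h => ?_, fun h => ?_⟩⟩
    · exact ⟨h.1.2, fun k hk => not_lt.1 fun hlt =>
        absurd (h.2 ⟨hlt.trans h.1.1, hk⟩) (not_le.2 hlt)⟩
    · obtain ⟨h1, h2, h3⟩ := h.1
      obtain ⟨z, hz, hz'⟩ := AmalgamGraph.exists_pow_mem_lt (φ := φ) (gen := gen) hφ hs
        (g := AmalgamGraph.wordVal φ gen s) (n := n) h1 h2 h3
      exact ⟨⟨(h.2 hz').trans_lt hz, h1, h2, h3⟩, fun k hk => h.2 hk.2⟩
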